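/- Consider $n$ nodes $V=\{1,\dots,n\}$ communicating in synchronous rounds; in each round every node can send one message to every node (including itself). In the symmetric information distribution task, every node initially holds exactly $n$ distinguishable messages, each with a destination in $V$, and every node is the destination of exactly $n$ messages; all messages have to be delivered to their destinations. Let $0\le p<1$ be a constant. Put $k(1)=1$ and $k(i+1)=\min\{k(i)\,e^{\lfloor k(i)\rfloor(1-p)^4/5},\log_2 n\}$. Given a number $r(n)$ of phases, algorithm $\mathcal A_l(p)$ executes for $i=1,\dots,r(n)$ the following phase and then terminates: 1. Each node creates $\lfloor k(i)\rfloor$ copies of each message it still holds and distributes its copies uniformly at random among all nodes, under the constraint that the numbers of copies any two nodes receive from it differ by at most one (independently for different senders and phases). 2. Each node forwards to each node $v$ one of the copies destined to $v$ that it received in step 1, if there is any. Any choice is feasible; it may depend on everything that has happened so far. 3. Each destination confirms every received copy to the node that forwarded it. 4. Each confirmation that arrives is forwarded to the original sender of the corresponding copy. 5. Each node deletes its messages for which a confirmation has arrived, and all copies. Every transmission in steps 1 to 4 is lost independently of everything else, with a probability of at most $p$ (which may depend on the phase, the step and the link). Each of the steps 1 to 4 takes as many rounds as the largest number of messages that have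 to be sent over one link in one direction in that step, and at least one. **Theorem.** For every constant $p\in[0,1)$ there are a constant $C$ and a function $r$ with $r(n)\le C\log^* n$ for all $n$ such that the following holds for every constant $c>0$ and all sufficiently large $n$ (depending on $p$ and $c$). On every instance of the symmetric information distribution task with $n$ nodes, for all feasible choices in step 2 and all loss probabilities of at most $p$, with probability at least $1-n^{-c}$ algorithm $\mathcal A_l(p)$ with $r(n)$ phases delivers all messages to their destinations and terminates within $C\log^* n$ rounds. Here $\log^* n$ is the least height $t$ of a tower of twos $2^{2^{\cdot^{\cdot^{2}}}}$ with value at least $n$ (height $0$ has value $1$). -/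

import Mathlib

open scoped ENNReal

noncomputable section

namespace LossyDistribution

/-! ### The iterated logarithm -/

/-- The power tower `2 ^ (2 ^ (⋯ ^ 2))` of height `t`; `tower 0 = 1`. -/
def tower : ℕ → ℕ
  | 0 => 1
  | t + 1 => 2 ^ tower t

theorem le_tower (n : ℕ) : n ≤ tower n := by
  induction n with
  | zero => exact Nat.zero_le _
  | succ n ih => exact Nat.succ_le_of_lt (lt_of_le_of_lt ih Nat.lt_two_pow_self)

/-- `log* n`: the least height of a power tower of twos that reaches `n`. -/
def logStar (n : ℕ) : ℕ := Nat.find (⟨n, le_tower n⟩ : ∃ t, n ≤ tower t)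

/-! ### The problem -/

/-- An instance of the information distribution task on the node set `Fin n`: a set `M` of
(distinguishable) messages, each with a node initially holding it and a destination. -/
structure Task (n : ℕ) (M : Type*) where
  src : M → Fin n
  dest : M → Fin n

/-- The symmetric task: every node has to send exactly `n` and to receive exactly `n` messages. -/
def Task.IsSymmetric {n : ℕ} {M : Type*} [Fintype M] (T : Task n M) : Prop :=
  ∀ v : Fin n, (Finset.univ.filter fun m => T.src m = v).card = n ∧
    (Finset.univ.filter fun m => T.dest m = v).card = n

/-! ### The algorithm -/

/-- The real parameter that controls the number of copies; `copyParam p n i` is the value in the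
`i`-th phase, phases being numbered from `0`. -/
def copyParam (p : ℝ) (n : ℕ) : ℕ → ℝ
  | 0 => 1
  | i + 1 => min (copyParam p n i * Real.exp (⌊copyParam p n i⌋₊ * (1 - p) ^ 4 / 5))
      (Real.logb 2 n)

/-- The number of copies made of every message that is still held in phase `i`. -/
def numCopies (p : ℝ) (n i : ℕ) : ℕ := ⌊copyParam p n i⌋₊

/-- A copy of a message, in a phase in which `k` copies of each message are made. -/
abbrev Copy (M : Type*) (k : ℕ) := M × Fin k

/-- The random outcome of one phase. `relay c` is the node to which the copy `c` is sent in the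
first step. `lost (s, c)` says whether the transmission that concerns the copy `c` in step `s` is
lost; the communication steps are `0` (sender to relay), `1` (relay to destination),
`2` (confirmation, destination to relay) and `3` (confirmation, relay to sender). -/
structure PhaseOutcome (n : ℕ) (M : Type*) where
  copies : ℕ
  relay : Copy M copies → Fin n
  lost : Fin 4 × Copy M copies → Bool

/-- The state of the network between two phases: the messages their senders have not yet deleted,
the messages of which some copy has reached the destination, the number of communication rounds
that have passed, and everything that happened before (latest phase first). -/
structure State (n : ℕ) (M : Type*) where
  held : Finset M
  delivered : Finset M
  rounds : ℕ
  history : List (PhaseOutcome n M)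

/-- The state before the first phase. -/
def State.init (n : ℕ) (M : Type*) [Fintype M] : State n M where
  held := Finset.univ
  delivered := ∅
  rounds := 0
  history := []

/-- A rule by which a relay `w` that has received a nonempty set `S` of copies destined to `v`
chooses the one it forwards. The choice may depend on the whole past and on everything that
happened in the first step of the present phase. -/
structure TieRule (n : ℕ) (M : Type*) where
  choose : State n M → (k : ℕ) → (relay : Copy M k → Fin n) → (lost : Copy M k → Bool) →
    (w v : Fin n) → (S : Finset (Copy M k)) → S.Nonempty → Copy M k
  choose_mem : ∀ s k relay lost w v S hS, choose s k relay lost w v S hS ∈ S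

section Phase

variable {n : ℕ} {M : Type*} [Fintype M] [DecidableEq M]

/-- Every sender distributes the copies of the messages in `H` that it holds such that, up to one,
all nodes receive the same number of them. (The values of `relay` at copies of messages outside `H`
are irrelevant and unconstrained; such copies are never sent.) -/
def IsBalanced (T : Task n M) (H : Finset M) {k : ℕ} (relay : Copy M k → Fin n) : Prop :=
  ∀ v w w' : Fin n,
    (Finset.univ.filter fun c : Copy M k => c.1 ∈ H ∧ T.src c.1 = v ∧ relay c = w).card ≤
      (Finset.univ.filter fun c : Copy M k => c.1 ∈ H ∧ T.src c.1 = v ∧ relay c = w').card + 1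

open Classical in
/-- The finite set of all balanced distributions. -/
def balanced (T : Task n M) (H : Finset M) (k : ℕ) : Finset (Copy M k → Fin n) :=
  Finset.univ.filter fun relay => IsBalanced T H relay

theorem balanced_nonempty [NeZero n] (T : Task n M) (H : Finset M) (k : ℕ) :
    (balanced T H k).Nonempty := by
  classical
  let S : Fin n → Finset (Copy M k) := fun v =>
    Finset.univ.filter fun c => c.1 ∈ H ∧ T.src c.1 = v
  have hn : 0 < n := Nat.pos_of_ne_zero (NeZero.ne n)
  let f : Copy M k → Fin n := fun c =>
    if h : c ∈ S (T.src c.1) then ⟨((S (T.src c.1)).equivFin ⟨c, h⟩ : ℕ) % n, Nat.mod_lt _ hn⟩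
    else 0
  have key : ∀ v w : Fin n,
      (Finset.univ.filter fun c : Copy M k => c.1 ∈ H ∧ T.src c.1 = v ∧ f c = w).card =
        (S v).card / n + if (w : ℕ) % n < (S v).card % n then 1 else 0 := by
    intro v w
    rw [← Nat.count_modEq_card _ hn, Nat.count_eq_card_filter_range]
    refine Finset.card_bij (fun c hc => ((S v).equivFin ⟨c, ?_⟩ : ℕ)) ?_ ?_ ?_
    · simp only [Finset.mem_filter] at hc
      simp [S, hc.2.1, hc.2.2.1]
    · intro c hc
      simp only [Finset.mem_filter, Finset.mem_univ, true_and] at hc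
      obtain ⟨h1, rfl, h3⟩ := hc
      have hm : c ∈ S (T.src c.1) := by simp [S, h1]
      simp only [f, hm, dif_pos] at h3
      simp only [Finset.mem_filter, Finset.mem_range]
      refine ⟨Fin.is_lt _, ?_⟩
      have h4 := congrArg Fin.val h3
      change _ % n = _ % n
      rw [← h4]
      simp
    · intro c hc c' hc' h
      have := (S v).equivFin.injective (Fin.ext h)
      simpa using this
    · intro x hx
      simp only [Finset.mem_filter, Finset.mem_range] at hx
      obtain ⟨hx1, hx2⟩ := hx
      let y := (S v).equivFin.symm ⟨x, hx1⟩
      have hy : (y : Copy M k) ∈ S v := y.2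
      have hy' : (y : Copy M k).1 ∈ H ∧ T.src (y : Copy M k).1 = v := by
        have := hy
        simp only [S, Finset.mem_filter, Finset.mem_univ, true_and] at this
        exact this
      refine ⟨y, ?_, ?_⟩
      · simp only [Finset.mem_filter, Finset.mem_univ, true_and]
        refine ⟨hy'.1, hy'.2, ?_⟩
        obtain ⟨hy1, hy2⟩ := hy'
        have hm : (y : Copy M k) ∈ S (T.src (y : Copy M k).1) := by rw [hy2]; exact hy
        simp only [f, hm, dif_pos]
        apply Fin.ext
        have hval : ∀ u (hu : u = v) (h : (y : Copy M k) ∈ S u),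
            ((S u).equivFin ⟨y, h⟩ : ℕ) = x := by
          rintro u rfl h
          simp [y]
        simp only [hval _ hy2 hm]
        rw [hx2, Nat.mod_eq_of_lt w.2]
      · simp [y]
  refine ⟨f, ?_⟩
  simp only [balanced, Finset.mem_filter, Finset.mem_univ, true_and]
  intro v w w'
  rw [key, key]
  split_ifs <;> omega

/-- The link (origin, recipient) over which the transmission concerning the copy `c` in
communication step `s` is made. -/
def link (T : Task n M) {k : ℕ} (relay : Copy M k → Fin n) (s : Fin 4) (c : Copy M k) :
    Fin n × Fin n :=
  match s with
  | 0 => (T.src c.1, relay c)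
  | 1 => (relay c, T.dest c.1)
  | 2 => (T.dest c.1, relay c)
  | 3 => (relay c, T.src c.1)

/-- The number of rounds of communication step `s` if the transmissions concerning the copies in
`S` are made in it: a link carries one message per round in each direction, so this is the largest
number of messages on a link (a step without messages is counted as one round). -/
def stepRounds (T : Task n M) {k : ℕ} (relay : Copy M k → Fin n) (s : Fin 4)
    (S : Finset (Copy M k)) : ℕ :=
  max 1 (Finset.univ.sup fun e : Fin n × Fin n => (S.filter fun c => link T relay s c = e).card)

/-- The copies in `S` whose transmission in communication step `s` is not lost. -/
def survivors {k : ℕ} (lost : Fin 4 × Copy M k → Bool) (s : Fin 4) (S : Finset (Copy M k)) :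
    Finset (Copy M k) :=
  S.filter fun c => lost (s, c) = false

open Classical in
/-- The copies that are forwarded by their relays, if the copies in `A` have arrived at them: for
each relay `w` and each destination `v`, one of those at `w` destined to `v` (if there is any). -/
def forwarded (T : Task n M) (tie : TieRule n M) (st : State n M) {k : ℕ}
    (relay : Copy M k → Fin n) (lost : Copy M k → Bool) (A : Finset (Copy M k)) :
    Finset (Copy M k) :=
  A.filter fun c =>
    ∃ hS : (A.filter fun c' => relay c' = relay c ∧ T.dest c'.1 = T.dest c.1).Nonempty,
      tie.choose st k relay lost (relay c) (T.dest c.1) _ hS = c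

/-- The state after a phase, given the random outcome of the phase. -/
def nextState (T : Task n M) (tie : TieRule n M) (st : State n M) (o : PhaseOutcome n M) :
    State n M :=
  let sent : Finset (Copy M o.copies) := Finset.univ.filter fun c => c.1 ∈ st.held
  let arrived := survivors o.lost 0 sent
  let fwd := forwarded T tie st o.relay (fun c => o.lost (0, c)) arrived
  let received := survivors o.lost 1 fwd
  let confirmedToRelay := survivors o.lost 2 received
  let confirmed := survivors o.lost 3 confirmedToRelay
  { held := st.held \ confirmed.image Prod.fst
    delivered := st.delivered ∪ received.image Prod.fst
    rounds := st.rounds + stepRounds T o.relay 0 sent + stepRounds T o.relay 1 fwd +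
      stepRounds T o.relay 2 received + stepRounds T o.relay 3 confirmedToRelay
    history := o :: st.history }

end Phase

/-- Independent random bits, the bit `e` being `true` with probability `a e`. -/
def independentBits {ι : Type*} [Fintype ι] (a : ι → unitInterval) : PMF (ι → Bool) := by
  classical
  exact PMF.ofFintype
    (fun b => ∏ e, if b e then ENNReal.ofReal (a e) else ENNReal.ofReal (1 - a e))
    (by
      rw [← Fintype.prod_sum fun e (x : Bool) =>
        if x then ENNReal.ofReal (a e) else ENNReal.ofReal (1 - a e)]
      refine Finset.prod_eq_one fun e _ => ?_
      rw [Fintype.sum_bool, if_pos rfl, if_neg Bool.false_ne_true,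
        ← ENNReal.ofReal_add (a e).2.1 (sub_nonneg.2 (a e).2.2), add_sub_cancel,
        ENNReal.ofReal_one])

/-- Phase `i` with `k` copies of each held message: the copies are distributed uniformly at random
among the balanced distributions, and then each transmission is lost independently, a transmission
in communication step `s` from `u` to `w` with probability `q i s u w`. -/
def phase {n : ℕ} [NeZero n] {M : Type*} [Fintype M] [DecidableEq M] (T : Task n M)
    (tie : TieRule n M) (q : ℕ → Fin 4 → Fin n → Fin n → unitInterval) (i k : ℕ)
    (st : State n M) : PMF (State n M) :=
  (PMF.uniformOfFinset (balanced T st.held k) (balanced_nonempty T st.held k)).bind fun relay =>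
    (independentBits fun e : Fin 4 × Copy M k =>
        q i e.1 (link T relay e.1 e.2).1 (link T relay e.1 e.2).2).map fun lost =>
      nextState T tie st ⟨k, relay, lost⟩

/-- The random state after the first `r` phases of the algorithm with parameter `p`. -/
def run {n : ℕ} [NeZero n] {M : Type*} [Fintype M] [DecidableEq M] (p : ℝ) (T : Task n M)
    (tie : TieRule n M) (q : ℕ → Fin 4 → Fin n → Fin n → unitInterval) : ℕ → PMF (State n M)
  | 0 => PMF.pure (State.init n M)
  | i + 1 => (run p T tie q i).bind (phase T tie q i (numCopies p n i))

end LossyDistribution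

end

set_option linter.unusedSectionVars false

/-! Put δ = (1 - p)^4, a lower bound for the probability that all four transmissions concerning a
copy succeed. As long as no sender has more than n copies to distribute, a balanced distribution is
the same as a relay map that is injective on the copies of each sender
(`balanced_eq_classInjective`); then no link is ever used twice in a step, and a phase costs at most
four rounds (`rounds_nextState_le`).

Messages do not survive a phase independently: relays are coupled by injectivity, and an adversary
picks the forwarded copies. Concentration therefore comes from factorial moments. It suffices to
show that j given messages all survive with probability at most ρ^j, where j = ⌊√n⌋;
`toOuterMeasure_card_ge_le` turns this into a tail bound of order exp(-Ω(√n)) for the number of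
survivors. The product bound rests on copies that share relay and destination with no relevant other
copy: no choice rule can suppress them, so only losses can (`independentBits_all_lost_le`).
Revealing the relays one by one bounds the generating function of the number of such copies
(`sum_pow_card_alone_le`); together this is `outcome_subset_held_le`.

The run has three stages. During a constant number of phases a single copy is made. The load may be
so high that collisions dominate, so at the destinations one counts relays instead of messages:
about a fraction 1 - exp(-z) of them receive something for a destination with load z n
(`sum_pow_card_hit_le`). This reduces the destination loads geometrically, and with them the
collisions that hold up the senders; `exists_load_lt` shows that the loads end up small enough. From
then on, with K the copy parameter, every node holds at most n/(3K) messages and at most n/(4K) are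
destined to it. A message survives with probability at most exp(-3δk/10), more than enough to
reproduce this invariant with K exp(kδ/5) in place of K (`outcome_filter_le_of_low_load`). Two such
phases at least replace a large K by 2^K, so K reaches log₂ n within O(log* n) phases
(`exists_copyParam_eq_logb`).

At the maximum number of copies a message survives a phase with probability n^(-Ω(1)), hence log* n
such phases with probability n^(-Ω(log* n)), up to the failure of the invariant (`run_mem_held_le`).
Since log* n is unbounded, this beats every n^(-c) after a union bound over the n² messages. -/

namespace LossyDistribution

/-! ### Uniformly random functions that are injective on classes -/

section ClassInjective

variable {C B I : Type*} [Fintype C] [DecidableEq C] [Fintype B] [DecidableEq B] [DecidableEq I]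

/-- The functions that are injective on every class of the labelling `s`. -/
def classInjective (B : Type*) [Fintype B] [DecidableEq B] (s : C → I) : Finset (C → B) :=
  Finset.univ.filter fun f => ∀ c c', s c = s c' → f c = f c' → c = c'

theorem mem_classInjective {s : C → I} {f : C → B} :
    f ∈ classInjective B s ↔ ∀ c c', s c = s c' → f c = f c' → c = c' := by
  simp [classInjective]

/-- Exchange the values `f x` and `b` on the class of `x`. -/
def exchange (s : C → I) (x : C) (f : C → B) (b : B) : C → B :=
  fun c => if s c = s x then Equiv.swap (f x) b (f c) else f c

theorem exchange_self (s : C → I) (x : C) (f : C → B) (b : B) : exchange s x f b x = b := by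
  simp [exchange]

theorem exchange_exchange (s : C → I) (x : C) (f : C → B) (b : B) :
    exchange s x (exchange s x f b) (f x) = f := by
  funext c
  by_cases h : s c = s x
  · simp [exchange, h, Equiv.swap_comm b (f x)]
  · simp [exchange, h]

theorem exchange_mem {s : C → I} {x : C} {f : C → B} (hf : f ∈ classInjective B s) (b : B) :
    exchange s x f b ∈ classInjective B s := by
  rw [mem_classInjective] at *
  intro c c' h h'
  by_cases hx : s c = s x
  · simp only [exchange, hx, ← h, if_true] at h'
    exact hf c c' h ((Equiv.swap (f x) b).injective h')
  · simp only [exchange, hx, ← h, if_false] at h'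
    exact hf c c' h h'

/-- Within the class of `x`, injectivity reserves the value `f x` for `x`, and `b` is not taken on
`D`. The swap thus moves no value on `D`, and quantities that depend only on `D` are unchanged. -/
theorem exchange_apply_of_mem {s : C → I} {x : C} {f : C → B} (hf : f ∈ classInjective B s)
    {D : Finset C} (hx : x ∉ D) {b : B} (hb : b ∉ (D.filter fun c => s c = s x).image f)
    {c : C} (hc : c ∈ D) : exchange s x f b c = f c := by
  rw [mem_classInjective] at hf
  by_cases h : s c = s x
  · simp only [exchange, h, if_true]
    apply Equiv.swap_apply_of_ne_of_ne
    · intro h'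
      exact hx (hf c x h h' ▸ hc)
    · rintro rfl
      exact hb (Finset.mem_image_of_mem f (Finset.mem_filter.2 ⟨hc, h⟩))
  · simp [exchange, h]

/-- The number of values in a set `R f` that a random function takes at `x`, in the presence of a
weight `G f`, if both depend only on the values of `f` on a set `D` that does not contain `x`. -/
theorem sum_classInjective_mem (s : C → I) (D : Finset C) {x : C} (hx : x ∉ D)
    (G : (C → B) → ℝ) (hG : ∀ f g, (∀ c ∈ D, f c = g c) → G f = G g)
    (R : (C → B) → Finset B) (hR : ∀ f g, (∀ c ∈ D, f c = g c) → R f = R g) :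
    ((Fintype.card B : ℝ) - (D.filter fun c => s c = s x).card) *
        (∑ f ∈ classInjective B s, if f x ∈ R f then G f else 0) =
      ∑ f ∈ classInjective B s,
        G f * ((R f \ (D.filter fun c => s c = s x).image f).card : ℝ) := by
  set E := D.filter fun c => s c = s x with hE
  have hcard : ∀ f ∈ classInjective B s, (((E.image f)ᶜ.card : ℕ) : ℝ) =
      (Fintype.card B : ℝ) - E.card := by
    intro f hf
    rw [mem_classInjective] at hf
    rw [Finset.card_compl, Nat.cast_sub (Finset.card_le_univ _), Finset.card_image_of_injOn]
    intro c hc c' hc' h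
    simp only [hE, Finset.coe_filter, Set.mem_ofPred_eq] at hc hc'
    exact hf c c' (hc.2.trans hc'.2.symm) h
  have h1 : ((Fintype.card B : ℝ) - E.card) *
        (∑ f ∈ classInjective B s, if f x ∈ R f then G f else 0) =
      ∑ f ∈ classInjective B s, ∑ b ∈ (E.image f)ᶜ, if f x ∈ R f then G f else 0 := by
    rw [Finset.mul_sum]
    refine Finset.sum_congr rfl fun f hf => ?_
    rw [Finset.sum_const, nsmul_eq_mul, hcard f hf]
  have h2 : ∑ f ∈ classInjective B s, G f * ((R f \ E.image f).card : ℝ) =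
      ∑ f ∈ classInjective B s, ∑ b ∈ (E.image f)ᶜ, if b ∈ R f then G f else 0 := by
    refine Finset.sum_congr rfl fun f hf => ?_
    rw [← Finset.sum_filter, Finset.sum_const, nsmul_eq_mul, mul_comm]
    congr 3
    ext b
    simp [and_comm]
  have key : ∀ (f : C → B) (b : B), f ∈ classInjective B s → b ∉ E.image f →
      f x ∉ E.image (exchange s x f b) := by
    intro f b hf hb h
    obtain ⟨c, hc, hc'⟩ := Finset.mem_image.1 h
    have hcD := (Finset.mem_filter.1 hc)
    rw [exchange_apply_of_mem hf hx hb hcD.1] at hc'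
    exact hx (mem_classInjective.1 hf c x hcD.2 hc' ▸ hcD.1)
  rw [h1, h2, Finset.sum_sigma', Finset.sum_sigma']
  -- Exchanging `f x` with a free value `b` is an involution on the pairs `(f, b)`. It expresses
  -- that, given `f` on `D`, the value at `x` is uniform among those not yet used in its class.
  refine Finset.sum_nbij' (fun y => ⟨exchange s x y.1 y.2, y.1 x⟩)
    (fun y => ⟨exchange s x y.1 y.2, y.1 x⟩) ?_ ?_ ?_ ?_ ?_
  all_goals try
    rintro ⟨f, b⟩ hy
    simp only [Finset.mem_sigma, Finset.mem_compl] at hy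
    obtain ⟨hf, hb⟩ := hy
  · simpa only [Finset.mem_sigma, Finset.mem_compl] using ⟨exchange_mem hf b, key f b hf hb⟩
  · simpa only [Finset.mem_sigma, Finset.mem_compl] using ⟨exchange_mem hf b, key f b hf hb⟩
  · simp [exchange_exchange, exchange_self]
  · simp [exchange_exchange, exchange_self]
  · have hD : ∀ c ∈ D, exchange s x f b c = f c := fun c hc => exchange_apply_of_mem hf hx hb hc
    simp only [hG _ _ hD, hR _ _ hD]

/-- The probability that `f x` lies in a set of at most `t` values is at most `t / (|B| - l)`, even
in the presence of a nonnegative weight, if both depend only on `f` on a set `D` that contains at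
most `l` elements of the class of `x`. -/
theorem sum_classInjective_mem_le (s : C → I) (D : Finset C) {x : C} (hx : x ∉ D)
    (G : (C → B) → ℝ) (hG : ∀ f g, (∀ c ∈ D, f c = g c) → G f = G g) (hG0 : ∀ f, 0 ≤ G f)
    (R : (C → B) → Finset B) (hR : ∀ f g, (∀ c ∈ D, f c = g c) → R f = R g) {t l : ℝ}
    (ht : ∀ f, ((R f).card : ℝ) ≤ t) (hl : ((D.filter fun c => s c = s x).card : ℝ) ≤ l)
    (hl' : l < Fintype.card B) :
    (∑ f ∈ classInjective B s, if f x ∈ R f then G f else 0) ≤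
      t / (Fintype.card B - l) * ∑ f ∈ classInjective B s, G f := by
  have h := sum_classInjective_mem s D hx G hG R hR
  have h0 : 0 ≤ ∑ f ∈ classInjective B s, if f x ∈ R f then G f else 0 :=
    Finset.sum_nonneg fun f _ => by split_ifs <;> simp [hG0]
  have h1 : ∑ f ∈ classInjective B s,
        G f * ((R f \ (D.filter fun c => s c = s x).image f).card : ℝ) ≤
      t * ∑ f ∈ classInjective B s, G f := by
    rw [Finset.mul_sum]
    refine Finset.sum_le_sum fun f _ => ?_
    rw [mul_comm]
    refine mul_le_mul_of_nonneg_right (le_trans ?_ (ht f)) (hG0 f)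
    exact_mod_cast Finset.card_le_card Finset.sdiff_subset
  rw [div_mul_eq_mul_div, le_div_iff₀ (by linarith), mul_comm]
  refine le_trans (mul_le_mul_of_nonneg_right ?_ h0) (h.trans_le h1)
  linarith

/-- The probability that a random function avoids a set `W` of values on `D`. -/
theorem card_classInjective_avoid_le (s : C → I) (W : Finset B) (D : Finset C) :
    (((classInjective B s).filter fun f => ∀ c ∈ D, f c ∉ W).card : ℝ) ≤
      (1 - W.card / Fintype.card B) ^ D.card * (classInjective B s).card := by
  rcases (Finset.card_le_univ W).eq_or_lt with hW | hW
  · rcases isEmpty_or_nonempty B with hB | hB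
    · rw [Fintype.card_eq_zero (α := B)]
      simp only [Nat.cast_zero, div_zero, sub_zero, one_pow, one_mul]
      exact_mod_cast Finset.card_filter_le _ _
    · have hn : (Fintype.card B : ℝ) ≠ 0 := by exact_mod_cast Fintype.card_ne_zero
      rw [hW, div_self hn, sub_self]
      rcases D.eq_empty_or_nonempty with rfl | ⟨c, hc⟩
      · simp
      · rw [Finset.filter_false_of_mem]
        · simp only [Finset.card_empty, Nat.cast_zero]
          positivity
        · intro f _ h
          refine h c hc ?_
          rw [Finset.card_eq_iff_eq_univ] at hW
          simp [hW]
  have hn0 : (0 : ℝ) < Fintype.card B := by exact_mod_cast (Nat.zero_le _).trans_lt hW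
  have hW' : (W.card : ℝ) < Fintype.card B := by exact_mod_cast hW
  have hq : 0 ≤ 1 - (W.card : ℝ) / Fintype.card B := by
    rw [sub_nonneg, div_le_one hn0]; exact hW'.le
  induction D using Finset.induction with
  | empty => simp
  | insert x D hx ih =>
    rw [Finset.card_insert_of_notMem hx, pow_succ', mul_assoc]
    refine le_trans ?_ (mul_le_mul_of_nonneg_left ih hq)
    set G : (C → B) → ℝ := fun f => if ∀ c ∈ D, f c ∉ W then 1 else 0 with hGdef
    have hG : ∀ f g, (∀ c ∈ D, f c = g c) → G f = G g := by
      intro f g h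
      have : (∀ c ∈ D, f c ∉ W) ↔ ∀ c ∈ D, g c ∉ W :=
        forall₂_congr fun c hc => by rw [h c hc]
      simp only [hGdef, this]
    have h := sum_classInjective_mem s D hx G hG (fun _ => W) (fun _ _ _ => rfl)
    set E := D.filter fun c => s c = s x with hE
    -- If `D` avoids `W`, all of `W` is still available to `x`, out of at most `|B|` values.
    -- Injectivity therefore only makes hitting `W` more likely than for independent values.
    have h2 : ∑ f ∈ classInjective B s, G f * ((W \ E.image f).card : ℝ) =
        W.card * ∑ f ∈ classInjective B s, G f := by
      rw [Finset.mul_sum]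
      refine Finset.sum_congr rfl fun f _ => ?_
      by_cases hf : ∀ c ∈ D, f c ∉ W
      · rw [mul_comm, Finset.sdiff_eq_self_of_disjoint]
        rw [Finset.disjoint_left]
        intro b hb hb'
        obtain ⟨c, hc, rfl⟩ := Finset.mem_image.1 hb'
        exact hf c (Finset.mem_filter.1 hc).1 hb
      · simp [hGdef, hf]
    rw [h2] at h
    have h3 : (((classInjective B s).filter fun f => ∀ c ∈ D, f c ∉ W).card : ℝ) =
        ∑ f ∈ classInjective B s, G f := by
      rw [Finset.card_filter]; push_cast; rfl
    have h4 : (((classInjective B s).filter fun f => ∀ c ∈ insert x D, f c ∉ W).card : ℝ) =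
        (∑ f ∈ classInjective B s, G f) -
          ∑ f ∈ classInjective B s, if f x ∈ W then G f else 0 := by
      rw [Finset.card_filter, ← Finset.sum_sub_distrib]
      push_cast
      refine Finset.sum_congr rfl fun f _ => ?_
      simp only [Finset.forall_mem_insert, hGdef]
      by_cases h1 : f x ∈ W <;> simp [h1]
    rw [h3, h4, sub_mul, one_mul, sub_le_sub_iff_left, div_mul_eq_mul_div, div_le_iff₀ hn0, ← h,
      mul_comm (∑ f ∈ _, _)]
    refine mul_le_mul_of_nonneg_right (by simp) (Finset.sum_nonneg fun f _ => ?_)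
    simp only [hGdef]
    split_ifs <;> simp

/-- A bound on the generating function of the number of values in `W` that a random function takes
on `D`. -/
theorem sum_pow_card_hit_le (s : C → I) (W : Finset B) (D : Finset C) {δ : ℝ} (h0 : 0 ≤ δ)
    (h1 : δ ≤ 1) :
    ∑ f ∈ classInjective B s, (1 - δ) ^ (W.filter fun w => ∃ c ∈ D, f c = w).card ≤
      (1 - δ * (1 - Real.exp (-(D.card / Fintype.card B)))) ^ W.card *
        (classInjective B s).card := by
  have hpow : ∀ f : C → B, (1 - δ) ^ (W.filter fun w => ∃ c ∈ D, f c = w).card =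
      ∑ U ∈ W.powerset, δ ^ U.card * (1 - δ) ^ (W \ U).card *
        (if ∀ c ∈ D, f c ∉ U then 1 else 0) := by
    intro f
    -- A value contributes `1 - δ` if it is hit and `δ + (1 - δ)` if not. Expanding the product over
    -- subsets `U` of `W` leaves only events that `D` avoids `U`.
    have : (1 - δ) ^ (W.filter fun w => ∃ c ∈ D, f c = w).card =
        ∏ w ∈ W, ((if ∀ c ∈ D, f c ≠ w then δ else 0) + (1 - δ)) := by
      rw [← Finset.prod_const, Finset.prod_filter]
      refine Finset.prod_congr rfl fun w _ => ?_
      by_cases h : ∃ c ∈ D, f c = w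
      · have h' : ¬ ∀ c ∈ D, f c ≠ w := by push Not; exact h
        simp [h]
      · have h' : ∀ c ∈ D, f c ≠ w := by push Not at h; exact h
        rw [if_neg h, if_pos h']
        ring
    rw [this, Finset.prod_add]
    refine Finset.sum_congr rfl fun U _ => ?_
    rw [Finset.prod_const]
    by_cases h : ∀ c ∈ D, f c ∉ U
    · rw [if_pos h, mul_one, Finset.prod_congr rfl fun w hw => if_pos ?_, Finset.prod_const]
      rintro c hc rfl
      exact h c hc hw
    · rw [if_neg h, mul_zero]
      push Not at h
      obtain ⟨c, hc, hU⟩ := h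
      rw [Finset.prod_eq_zero hU, zero_mul]
      rw [if_neg]
      push Not
      exact ⟨c, hc, rfl⟩
  simp only [hpow]
  rw [Finset.sum_comm]
  set e := Real.exp (-(D.card / Fintype.card B)) with he
  have hfac : (1 - δ * (1 - e)) ^ W.card = ∏ w ∈ W, (δ * e + (1 - δ)) := by
    rw [Finset.prod_const]; congr 1; ring
  rw [hfac, Finset.prod_add, Finset.sum_mul]
  refine Finset.sum_le_sum fun U _ => ?_
  rw [← Finset.mul_sum, Finset.prod_const, Finset.prod_const, mul_pow]
  have h2 := card_classInjective_avoid_le s U D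
  rw [Finset.card_filter] at h2
  push_cast at h2
  have h3 : (1 - (U.card : ℝ) / Fintype.card B) ^ D.card ≤ e ^ U.card := by
    have hle : (U.card : ℝ) / Fintype.card B ≤ 1 :=
      div_le_one_of_le₀ (by exact_mod_cast Finset.card_le_univ U) (Nat.cast_nonneg _)
    refine (pow_le_pow_left₀ (by linarith) (Real.one_sub_le_exp_neg _) _).trans_eq ?_
    rw [he, ← Real.exp_nat_mul, ← Real.exp_nat_mul]
    congr 1
    ring
  calc _ ≤ δ ^ U.card * (1 - δ) ^ (W \ U).card * (e ^ U.card * (classInjective B s).card) := by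
        refine mul_le_mul_of_nonneg_left (h2.trans ?_) ?_
        · exact mul_le_mul_of_nonneg_right h3 (Nat.cast_nonneg _)
        · have : 0 ≤ 1 - δ := by linarith
          positivity
    _ = _ := by ring

end ClassInjective

/-! ### Elements without collisions, and their generating function -/

section Alone

variable {C B I V : Type*} [Fintype C] [DecidableEq C] [Fintype B] [DecidableEq B] [DecidableEq I]
  [DecidableEq V]

/-- The elements of `A` that share their value under `f` with no other element of `D` with the same
label under `d`. -/
def alone (d : C → V) (D A : Finset C) (f : C → B) : Finset C :=
  A.filter fun c => ∀ c' ∈ D, d c' = d c → f c' = f c → c' = c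

theorem mem_alone {d : C → V} {D A : Finset C} {f : C → B} {c : C} :
    c ∈ alone d D A f ↔ c ∈ A ∧ ∀ c' ∈ D, d c' = d c → f c' = f c → c' = c := by
  simp [alone]

theorem alone_congr (d : C → V) {D A : Finset C} (hA : A ⊆ D) {f g : C → B}
    (h : ∀ c ∈ D, f c = g c) : alone d D A f = alone d D A g := by
  ext c
  rw [mem_alone, mem_alone]
  refine and_congr_right fun hc => forall₂_congr fun c' hc' => ?_
  rw [h c (hA hc), h c' hc']

/-- The factor on the right is `b`, `1` or `1 / b`. A new element without collision is alone and
spoils nothing; one that meets only elements outside `A` leaves the count at least as large; one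
that meets an element of `A` spoils at most one lone element, since a lone element shares its label
and value with no other. -/
theorem pow_card_alone_insert_le (d : C → V) {D A : Finset C} (hA : A ⊆ D) {x : C} (hx : x ∉ D)
    (f : C → B) {b : ℝ} (hb0 : 0 < b) (hb1 : b ≤ 1) :
    b ^ (alone d (insert x D) (insert x A) f).card ≤
      b * b ^ (alone d D A f).card +
        (1 - b) * (if f x ∈ (D.filter fun c => d c = d x).image f then
          b ^ (alone d D A f).card else 0) +
        (1 / b - 1) * (if f x ∈ (A.filter fun c => d c = d x).image f then
          b ^ (alone d D A f).card else 0) := by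
  have hxA : x ∉ A := fun h => hx (hA h)
  by_cases h1 : f x ∈ (D.filter fun c => d c = d x).image f
  · rw [if_pos h1]
    by_cases h2 : f x ∈ (A.filter fun c => d c = d x).image f
    · rw [if_pos h2]
      obtain ⟨y, hy, hyx⟩ := Finset.mem_image.1 h2
      obtain ⟨hyA, hyd⟩ := Finset.mem_filter.1 hy
      have hsub : (alone d D A f).card ≤ (alone d (insert x D) (insert x A) f).card + 1 := by
        rw [← tsub_le_iff_right]
        refine (Finset.pred_card_le_card_erase (a := y)).trans (Finset.card_le_card ?_)
        intro c hc
        obtain ⟨hcy, hc⟩ := Finset.mem_erase.1 hc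
        rw [mem_alone] at hc ⊢
        refine ⟨Finset.mem_insert_of_mem hc.1, fun c' hc' hd hf => ?_⟩
        rcases Finset.mem_insert.1 hc' with rfl | hc'
        · exact absurd (hc.2 y (hA hyA) (hyd.trans hd) (hyx.trans hf)) (Ne.symm hcy)
        · exact hc.2 c' hc' hd hf
      have : b ^ (alone d (insert x D) (insert x A) f).card * b ≤ b ^ (alone d D A f).card := by
        rw [← pow_succ]
        exact pow_le_pow_of_le_one hb0.le hb1 hsub
      calc _ ≤ b ^ (alone d D A f).card / b := by rwa [le_div_iff₀ hb0]
        _ = _ := by ring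
    · rw [if_neg h2]
      have : (alone d D A f).card ≤ (alone d (insert x D) (insert x A) f).card := by
        refine Finset.card_le_card fun c hc => ?_
        rw [mem_alone] at hc ⊢
        refine ⟨Finset.mem_insert_of_mem hc.1, fun c' hc' hd hf => ?_⟩
        rcases Finset.mem_insert.1 hc' with rfl | hc'
        · refine absurd ?_ h2
          rw [hf]
          exact Finset.mem_image_of_mem f (Finset.mem_filter.2 ⟨hc.1, hd.symm⟩)
        · exact hc.2 c' hc' hd hf
      refine (pow_le_pow_of_le_one hb0.le hb1 this).trans_eq ?_
      ring
  · have h2 : f x ∉ (A.filter fun c => d c = d x).image f := fun h =>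
      h1 (Finset.image_subset_image (Finset.filter_subset_filter _ hA) h)
    rw [if_neg h1, if_neg h2]
    have hne : ∀ c ∈ D, d c = d x → f c ≠ f x := by
      intro c hc hd hf
      apply h1
      rw [← hf]
      exact Finset.mem_image_of_mem f (Finset.mem_filter.2 ⟨hc, hd⟩)
    have : (alone d D A f).card + 1 ≤ (alone d (insert x D) (insert x A) f).card := by
      rw [← Finset.card_insert_of_notMem (a := x) (fun h => hxA (mem_alone.1 h).1)]
      refine Finset.card_le_card fun c hc => ?_
      rw [mem_alone]
      rcases Finset.mem_insert.1 hc with rfl | h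
      · refine ⟨Finset.mem_insert_self _ _, fun c' hc' hd hf => ?_⟩
        rcases Finset.mem_insert.1 hc' with rfl | hc'
        · rfl
        · exact absurd hf (hne c' hc' hd)
      · rw [mem_alone] at h
        refine ⟨Finset.mem_insert_of_mem h.1, fun c' hc' hd hf => ?_⟩
        rcases Finset.mem_insert.1 hc' with rfl | hc'
        · exact absurd hf.symm (hne c (hA h.1) hd.symm)
        · exact h.2 c' hc' hd hf
    refine (pow_le_pow_of_le_one hb0.le hb1 this).trans_eq ?_
    ring

/-- A bound on the generating function of the number of elements of `A` that are alone, for a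
function that is random subject to being injective on classes. -/
theorem sum_pow_card_alone_le (s : C → I) (d : C → V) {D A : Finset C} (hDA : Disjoint D A)
    {b m l a : ℝ} (hb0 : 0 < b) (hb1 : b ≤ 1) (ha : (A.card : ℝ) ≤ a)
    (hm : ∀ x ∈ A, ((D.filter fun c => d c = d x).card : ℝ) ≤ m)
    (hl : ∀ x ∈ A, (((D ∪ A).filter fun c => s c = s x).card : ℝ) ≤ l)
    (hlB : l < Fintype.card B) :
    ∑ f ∈ classInjective B s, b ^ (alone d (D ∪ A) A f).card ≤
      (b + (1 - b) * ((m + a) / (Fintype.card B - l)) + (1 / b - 1) * (a / (Fintype.card B - l))) ^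
        A.card * (classInjective B s).card := by
  set γ := b + (1 - b) * ((m + a) / (Fintype.card B - l)) +
    (1 / b - 1) * (a / (Fintype.card B - l)) with hγ
  have hb : 0 ≤ 1 / b - 1 := by
    rw [sub_nonneg, le_div_iff₀ hb0]; linarith
  have hBl : 0 < Fintype.card B - l := by linarith
  -- The elements of `A` are revealed one at a time. Given the earlier values, the new one hits an
  -- occupied value of its label with probability at most `(m + a) / (|B| - l)`, and one occupied by
  -- an element of `A` with probability at most `a / (|B| - l)`.
  suffices H : ∀ A' ⊆ A, ∑ f ∈ classInjective B s, b ^ (alone d (D ∪ A') A' f).card ≤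
      γ ^ A'.card * (classInjective B s).card from H A subset_rfl
  intro A'
  induction A' using Finset.induction with
  | empty => intro _; simp [alone]
  | insert x A' hx ih =>
    intro hsub
    have hxA : x ∈ A := hsub (Finset.mem_insert_self _ _)
    have hA' : A' ⊆ A := (Finset.subset_insert _ _).trans hsub
    have ha0 : 0 ≤ a := (Nat.cast_nonneg _).trans ha
    have hm0 : 0 ≤ m := (Nat.cast_nonneg _).trans (hm x hxA)
    have hγ0 : 0 ≤ γ := by
      have : 0 ≤ 1 - b := by linarith
      positivity
    have hxD : x ∉ D ∪ A' := by
      rw [Finset.mem_union, not_or]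
      exact ⟨fun h => Finset.disjoint_left.1 hDA h hxA, hx⟩
    rw [Finset.card_insert_of_notMem hx, pow_succ', mul_assoc, Finset.union_insert]
    refine le_trans ?_ (mul_le_mul_of_nonneg_left (ih hA') hγ0)
    refine (Finset.sum_le_sum fun f _ =>
      pow_card_alone_insert_le d Finset.subset_union_right hxD f hb0 hb1).trans ?_
    rw [Finset.sum_add_distrib, Finset.sum_add_distrib, ← Finset.mul_sum, ← Finset.mul_sum,
      ← Finset.mul_sum]
    have hcl : (((D ∪ A').filter fun c => s c = s x).card : ℝ) ≤ l := by
      refine le_trans ?_ (hl x hxA)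
      exact_mod_cast Finset.card_le_card (Finset.filter_subset_filter _
        (Finset.union_subset_union_right hA'))
    have hcA' : ((A'.filter fun c => d c = d x).card : ℝ) ≤ a := by
      refine le_trans ?_ ha
      exact_mod_cast Finset.card_le_card ((Finset.filter_subset _ _).trans hA')
    have hG : ∀ f g : C → B, (∀ c ∈ D ∪ A', f c = g c) →
        b ^ (alone d (D ∪ A') A' f).card = b ^ (alone d (D ∪ A') A' g).card := fun f g h => by
      rw [alone_congr d Finset.subset_union_right h]
    have h1 := sum_classInjective_mem_le s (D ∪ A') hxD _ hG (fun f => by positivity)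
      (fun f => ((D ∪ A').filter fun c => d c = d x).image f)
      (fun f g h => Finset.image_congr fun c hc => h c (Finset.mem_filter.1 hc).1)
      (t := m + a) (fun f => by
        refine le_trans (Nat.cast_le.2 Finset.card_image_le) ?_
        rw [Finset.filter_union]
        refine le_trans (Nat.cast_le.2 (Finset.card_union_le _ _)) ?_
        push_cast
        exact add_le_add (hm x hxA) hcA') hcl hlB
    have h2 := sum_classInjective_mem_le s (D ∪ A') hxD _ hG (fun f => by positivity)
      (fun f => (A'.filter fun c => d c = d x).image f)
      (fun f g h => Finset.image_congr fun c hc =>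
        h c (Finset.mem_union_right _ (Finset.mem_filter.1 hc).1))
      (t := a) (fun f => (Nat.cast_le.2 Finset.card_image_le).trans hcA') hcl hlB
    have h3 := mul_le_mul_of_nonneg_left h1 (sub_nonneg.2 hb1)
    have h4 := mul_le_mul_of_nonneg_left h2 hb
    refine (add_le_add (add_le_add le_rfl h3) h4).trans_eq ?_
    rw [hγ]
    ring

end Alone

/-! ### Probabilities of events under discrete distributions -/

section Probability

/-- Conditioning on the first stage: `A` collects the good states, and `E` those from which `B` is
still reachable. Keeping `E` apart lets the bound `c` multiply a probability that is already small.
-/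
theorem toOuterMeasure_bind_le {α β : Type*} (μ : PMF α) (f : α → PMF β) (A E : Set α) (B : Set β)
    {c : ℝ≥0∞} (h1 : ∀ a ∈ A, a ∈ E → (f a).toOuterMeasure B ≤ c)
    (h2 : ∀ a ∈ A, a ∉ E → (f a).toOuterMeasure B = 0) :
    (μ.bind f).toOuterMeasure B ≤ μ.toOuterMeasure Aᶜ + c * μ.toOuterMeasure E := by
  have hle1 : ∀ a, (f a).toOuterMeasure B ≤ 1 := fun a => by
    refine (MeasureTheory.measure_mono (Set.subset_univ B)).trans_eq ?_
    rw [PMF.toOuterMeasure_apply_eq_one_iff]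
    exact Set.subset_univ _
  rw [PMF.toOuterMeasure_bind_apply, PMF.toOuterMeasure_apply, PMF.toOuterMeasure_apply,
    ← ENNReal.tsum_mul_left, ← ENNReal.tsum_add]
  refine ENNReal.tsum_le_tsum fun a => ?_
  by_cases hA : a ∈ A
  · by_cases hE : a ∈ E
    · simp only [Set.mem_compl_iff, hA, not_true_eq_false, not_false_eq_true,
        Set.indicator_of_notMem, hE, Set.indicator_of_mem, zero_add]
      rw [mul_comm c]
      gcongr
      exact h1 a hA hE
    · simp [h2 a hA hE]
  · rw [Set.indicator_of_mem (show a ∈ Aᶜ from hA)]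
    refine le_trans ?_ le_self_add
    calc _ ≤ μ a * 1 := by gcongr; exact hle1 a
      _ = μ a := mul_one _

theorem one_sub_toOuterMeasure_compl_le {α : Type*} (μ : PMF α) (E : Set α) :
    1 - μ.toOuterMeasure Eᶜ ≤ μ.toOuterMeasure E := by
  rw [tsub_le_iff_right]
  have h : μ.toOuterMeasure Set.univ = 1 := by
    rw [PMF.toOuterMeasure_apply_eq_one_iff]
    exact Set.subset_univ _
  rw [← h, ← Set.union_compl_self E]
  exact MeasureTheory.measure_union_le _ _

theorem toOuterMeasure_biUnion_le {α ι : Type*} (μ : PMF α) (t : Finset ι) (E : ι → Set α)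
    {c : ℝ≥0∞} (h : ∀ i ∈ t, μ.toOuterMeasure (E i) ≤ c) :
    μ.toOuterMeasure (⋃ i ∈ t, E i) ≤ t.card * c := by
  refine (MeasureTheory.measure_biUnion_finset_le t E).trans ?_
  refine (Finset.sum_le_sum h).trans_eq ?_
  rw [Finset.sum_const, nsmul_eq_mul]

/-- The factorial moment method: if every set of `j` elements of a set of at most `h` elements is
contained in the random set `F` with probability at most `ρ ^ j`, then `F` is rarely much larger
than `ρ * h`. -/
theorem toOuterMeasure_card_ge_le {Ω α : Type*} [DecidableEq α] (μ : PMF Ω) (F : Ω → Finset α)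
    (U : Finset α) (hF : ∀ ω, F ω ⊆ U) {j : ℕ} {ρ h σ : ℝ} (hρ : 0 ≤ ρ) (hU : (U.card : ℝ) ≤ h)
    (hσ : (j : ℝ) < σ)
    (hS : ∀ S ∈ U.powersetCard j, μ.toOuterMeasure {ω | S ⊆ F ω} ≤ ENNReal.ofReal (ρ ^ j)) :
    μ.toOuterMeasure {ω | σ ≤ (F ω).card} ≤ ENNReal.ofReal ((ρ * h / (σ - j)) ^ j) := by
  set s := ⌈σ⌉₊ with hs
  have hσs : σ ≤ s := Nat.le_ceil σ
  have hjs : j < s := by exact_mod_cast hσ.trans_le hσs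
  -- Markov's inequality for the number of `j`-subsets of `F`: a set of at least `s` elements has at
  -- least `s.choose j` of them.
  have h1 : (s.choose j : ℝ≥0∞) * μ.toOuterMeasure {ω | σ ≤ (F ω).card} ≤
      ∑ S ∈ U.powersetCard j, μ.toOuterMeasure {ω | S ⊆ F ω} := by
    simp only [PMF.toOuterMeasure_apply]
    rw [← ENNReal.tsum_mul_left, ← Summable.tsum_finsetSum fun _ _ => ENNReal.summable]
    refine ENNReal.tsum_le_tsum fun ω => ?_
    by_cases hω : σ ≤ (F ω).card
    · rw [Set.indicator_of_mem (show ω ∈ {ω | σ ≤ ((F ω).card : ℝ)} from hω)]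
      have hsub : (F ω).powersetCard j ⊆ U.powersetCard j := Finset.powersetCard_mono (hF ω)
      refine le_trans ?_ (Finset.sum_le_sum_of_subset hsub)
      rw [Finset.sum_congr rfl (g := fun _ => μ ω), Finset.sum_const, nsmul_eq_mul,
        Finset.card_powersetCard]
      · gcongr
        exact Nat.ceil_le.2 hω
      · intro S hS
        exact Set.indicator_of_mem (show ω ∈ {ω | S ⊆ F ω} from (Finset.mem_powersetCard.1 hS).1) _
    · rw [Set.indicator_of_notMem (show ω ∉ {ω | σ ≤ ((F ω).card : ℝ)} from hω), mul_zero]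
      exact zero_le
  have h2 := h1.trans (Finset.sum_le_sum hS)
  rw [Finset.sum_const, nsmul_eq_mul, Finset.card_powersetCard] at h2
  have hc0 : 0 < s.choose j := Nat.choose_pos hjs.le
  have h3 : μ.toOuterMeasure {ω | σ ≤ (F ω).card} ≤
      (U.card.choose j : ℝ≥0∞) * ENNReal.ofReal (ρ ^ j) / s.choose j := by
    rw [ENNReal.le_div_iff_mul_le (Or.inl (by exact_mod_cast hc0.ne'))
      (Or.inl (ENNReal.natCast_ne_top _)), mul_comm]
    exact h2
  refine h3.trans ?_
  rw [← ENNReal.ofReal_natCast, ← ENNReal.ofReal_natCast (s.choose j),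
    ← ENNReal.ofReal_mul (Nat.cast_nonneg _), ← ENNReal.ofReal_div_of_pos (by exact_mod_cast hc0)]
  refine ENNReal.ofReal_le_ofReal ?_
  have hj0 : (0 : ℝ) < j.factorial := by exact_mod_cast j.factorial_pos
  have h4 : (U.card.choose j : ℝ) ≤ h ^ j / j.factorial :=
    (Nat.choose_le_pow_div j U.card).trans (by gcongr)
  have h5 : (σ - j) ^ j / j.factorial ≤ (s.choose j : ℝ) := by
    have : (((s + 1 - j : ℕ) : ℝ) ^ j) / (j.factorial : ℝ) ≤ s.choose j := by
      have := Nat.pow_le_choose (α := ℝ) j s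
      exact this
    refine le_trans ?_ this
    have hcast : ((s + 1 - j : ℕ) : ℝ) = (s : ℝ) + 1 - j := by
      rw [Nat.cast_sub (by omega)]; push_cast; ring
    have h0 : 0 ≤ σ - j := by linarith
    gcongr
    rw [hcast]
    linarith
  have hσj : 0 < σ - j := by linarith
  have h6 : 0 < (σ - j) ^ j / (j.factorial : ℝ) := by positivity
  calc (U.card.choose j : ℝ) * ρ ^ j / s.choose j
      ≤ h ^ j / j.factorial * ρ ^ j / ((σ - j) ^ j / j.factorial) := by
        have : 0 ≤ h := (Nat.cast_nonneg _).trans hU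
        gcongr
    _ = _ := by
        rw [div_pow, mul_pow]
        field_simp

end Probability

/-! ### Independent losses -/

section Losses

variable {C X : Type*} [Fintype C] [DecidableEq C] [Fintype X]

/-- Expectation of a product under a product measure; the coordinates outside `Q` integrate to one.
-/
theorem sum_prod_mul_prod (W : C → X → ℝ) (hW : ∀ c, ∑ x, W c x = 1) (Q : Finset C)
    (φ : C → X → ℝ) :
    ∑ b : C → X, (∏ c, W c (b c)) * ∏ c ∈ Q, φ c (b c) = ∏ c ∈ Q, ∑ x, W c x * φ c x := by
  have h : ∀ b : C → X, (∏ c, W c (b c)) * ∏ c ∈ Q, φ c (b c) =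
      ∏ c, (W c (b c) * if c ∈ Q then φ c (b c) else 1) := by
    intro b
    rw [Finset.prod_mul_distrib]
    congr 1
    rw [Finset.prod_ite_mem, Finset.univ_inter]
  simp only [h]
  rw [← Fintype.prod_sum fun c x => W c x * if c ∈ Q then φ c x else 1,
    ← Finset.prod_subset (Finset.subset_univ Q)]
  · exact Finset.prod_congr rfl fun c hc => by simp [hc]
  · intro c _ hc
    simp [hc, hW]

/-- The probability that a bit with parameter `x` has a given value. -/
def bitWeight (x : unitInterval) (b : Bool) : ℝ := if b then (x : ℝ) else 1 - x

theorem bitWeight_nonneg (x : unitInterval) (b : Bool) : 0 ≤ bitWeight x b := by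
  cases b
  · simpa [bitWeight] using x.2.2
  · simpa [bitWeight] using x.2.1

theorem sum_bitWeight (x : unitInterval) : ∑ b, bitWeight x b = 1 := by
  simp [bitWeight]

theorem sum_prod_bitWeight {ι : Type*} [Fintype ι] [DecidableEq ι] (x : ι → unitInterval) :
    ∑ b : ι → Bool, ∏ i, bitWeight (x i) (b i) = 1 := by
  rw [← Fintype.prod_sum fun i b => bitWeight (x i) b]
  exact Finset.prod_eq_one fun i _ => sum_bitWeight _

theorem independentBits_apply {ι : Type*} [Fintype ι] (x : ι → unitInterval) (b : ι → Bool) :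
    independentBits x b = ENNReal.ofReal (∏ i, bitWeight (x i) (b i)) := by
  rw [ENNReal.ofReal_prod_of_nonneg fun i _ => bitWeight_nonneg _ _]
  change (∏ i, if b i then ENNReal.ofReal (x i) else ENNReal.ofReal (1 - x i)) = _
  refine Finset.prod_congr rfl fun i _ => ?_
  cases b i <;> simp [bitWeight]

open Classical in
theorem independentBits_toOuterMeasure {ι : Type*} [Fintype ι] [DecidableEq ι]
    (x : ι → unitInterval) (E : Set (ι → Bool)) :
    (independentBits x).toOuterMeasure E =
      ENNReal.ofReal (∑ b : ι → Bool, if b ∈ E then ∏ i, bitWeight (x i) (b i) else 0) := by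
  rw [PMF.toOuterMeasure_apply_fintype, ENNReal.ofReal_sum_of_nonneg]
  · refine Finset.sum_congr rfl fun b _ => ?_
    by_cases hb : b ∈ E <;> simp [hb, independentBits_apply]
  · intro b _
    split_ifs
    · exact Finset.prod_nonneg fun i _ => bitWeight_nonneg _ _
    · exact le_rfl

/-- Separate the bits of the first step from those of the other steps. -/
def splitBits (C : Type*) : (Fin 4 × C → Bool) ≃ (C → Bool) × (C → Fin 3 → Bool) where
  toFun b := (fun c => b (0, c), fun c s => b (s.succ, c))
  invFun y := fun e => Fin.cases (y.1 e.2) (y.2 e.2) e.1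
  left_inv b := by
    funext ⟨s, c⟩
    refine Fin.cases ?_ (fun s => ?_) s <;> rfl
  right_inv y := rfl

theorem prod_bitWeight_splitBits (x : Fin 4 × C → unitInterval)
    (y : (C → Bool) × (C → Fin 3 → Bool)) :
    ∏ e, bitWeight (x e) ((splitBits C).symm y e) =
      (∏ c, bitWeight (x (0, c)) (y.1 c)) *
        ∏ c, ∏ s : Fin 3, bitWeight (x (s.succ, c)) (y.2 c s) := by
  rw [Fintype.prod_prod_type, Fin.prod_univ_succ]
  congr 1
  rw [Finset.prod_comm]
  rfl

open Classical in
/-- Let each element of `Q` that is not lost in the first step point to an element, different ones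
to different ones. The probability that all of these are lost in one of the other steps is
exponentially small. -/
theorem independentBits_all_lost_le (x : Fin 4 × C → unitInterval) {p : ℝ} (hp1 : p ≤ 1)
    (hx : ∀ e, (x e : ℝ) ≤ p) (Q : Finset C) (E : Set (Fin 4 × C → Bool))
    (g : (C → Bool) → C → C)
    (hg : ∀ b₀ : C → Bool, Set.InjOn (g b₀) {c | c ∈ Q ∧ b₀ c = false})
    (hE : ∀ b ∈ E, ∀ c ∈ Q, b (0, c) = false →
      ∃ s : Fin 3, b (s.succ, g (fun c => b (0, c)) c) = true) :
    (independentBits x).toOuterMeasure E ≤ ENNReal.ofReal ((1 - (1 - p) ^ 4) ^ Q.card) := by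
  rw [independentBits_toOuterMeasure]
  refine ENNReal.ofReal_le_ofReal ?_
  set τ : ℝ := 1 - (1 - p) ^ 3 with hτ
  rcases Q.eq_empty_or_nonempty with rfl | ⟨c₀, -⟩
  · simp only [Finset.card_empty, pow_zero]
    rw [← sum_prod_bitWeight x]
    refine Finset.sum_le_sum fun b _ => ?_
    split_ifs
    · exact le_rfl
    · exact Finset.prod_nonneg fun i _ => bitWeight_nonneg _ _
  have hp0 : 0 ≤ p := (x (0, c₀)).2.1.trans (hx _)
  have hτ0 : 0 ≤ τ := by
    rw [hτ, sub_nonneg]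
    exact pow_le_one₀ (by linarith) (by linarith)
  have hτ1 : τ ≤ 1 := by
    rw [hτ]
    have : 0 ≤ (1 - p) ^ 3 := pow_nonneg (by linarith) _
    linarith
  rw [← (splitBits C).symm.sum_comp, Fintype.sum_prod_type]
  -- The elements pointed to depend on the first-step bits only, so these are fixed first. Each of
  -- the distinct elements then independently suffers a later loss with probability at most `τ`.
  -- Averaging over the first step gives a factor of at most `p + (1 - p) * τ = 1 - (1 - p) ^ 4` for
  -- each element of `Q`.
  have hinner : ∀ b₀ : C → Bool,
      (∑ b' : C → Fin 3 → Bool, if (splitBits C).symm (b₀, b') ∈ E then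
        ∏ e, bitWeight (x e) ((splitBits C).symm (b₀, b') e) else 0) ≤
      (∏ c, bitWeight (x (0, c)) (b₀ c)) * ∏ c ∈ Q, if b₀ c then 1 else τ := by
    intro b₀
    set Q' := Q.filter fun c => b₀ c = false with hQ'
    have hinj : Set.InjOn (g b₀) Q' := by
      intro c hc c' hc' h
      simp only [hQ', Finset.coe_filter] at hc hc'
      exact hg b₀ hc hc' h
    have hprod : (∏ c ∈ Q, if b₀ c then 1 else τ) = ∏ c ∈ Q'.image (g b₀), τ := by
      rw [Finset.prod_const, Finset.card_image_of_injOn hinj, ← Finset.prod_const, hQ',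
        Finset.prod_filter]
      refine Finset.prod_congr rfl fun c _ => ?_
      cases b₀ c <;> simp
    have hW : ∀ c, ∑ y : Fin 3 → Bool, ∏ s : Fin 3, bitWeight (x (s.succ, c)) (y s) = 1 :=
      fun c => sum_prod_bitWeight _
    have hall : ∀ c, ∑ y : Fin 3 → Bool, (∏ s : Fin 3, bitWeight (x (s.succ, c)) (y s)) *
        (if ∃ s, y s = true then 1 else 0) ≤ τ := by
      intro c
      have h1 : ∀ y : Fin 3 → Bool, (∏ s : Fin 3, bitWeight (x (s.succ, c)) (y s)) *
          (if ∃ s, y s = true then 1 else 0) =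
          (∏ s : Fin 3, bitWeight (x (s.succ, c)) (y s)) -
          if y = fun _ => false then (∏ s : Fin 3, bitWeight (x (s.succ, c)) false) else 0 := by
        intro y
        by_cases hy : y = fun _ => false
        · subst hy; simp
        · have : ∃ s, y s = true := by
            by_contra! h
            exact hy (funext fun s => by simpa using h s)
          simp [hy, this]
      simp only [h1]
      rw [Finset.sum_sub_distrib, hW, Finset.sum_ite_eq' Finset.univ (fun _ : Fin 3 => false),
        if_pos (Finset.mem_univ _), hτ]
      have : (1 - p) ^ 3 ≤ ∏ s : Fin 3, bitWeight (x (s.succ, c)) false := by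
        rw [← Fin.prod_const]
        refine Finset.prod_le_prod (fun _ _ => by linarith) fun s _ => ?_
        simp only [bitWeight, Bool.false_eq_true, if_false]
        linarith [hx (s.succ, c)]
      linarith
    calc _ ≤ ∑ b' : C → Fin 3 → Bool, (∏ c, bitWeight (x (0, c)) (b₀ c)) *
          ((∏ c, ∏ s : Fin 3, bitWeight (x (s.succ, c)) (b' c s)) *
            ∏ c ∈ Q'.image (g b₀), if ∃ s, b' c s = true then 1 else 0) := by
          refine Finset.sum_le_sum fun b' _ => ?_
          rw [← mul_assoc, ← prod_bitWeight_splitBits x (b₀, b')]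
          split_ifs with h
          · rw [Finset.prod_eq_one (s := Q'.image (g b₀)), mul_one]
            intro c hc
            obtain ⟨c', hc', rfl⟩ := Finset.mem_image.1 hc
            obtain ⟨hc'Q, hc'0⟩ := Finset.mem_filter.1 hc'
            exact if_pos (hE _ h c' hc'Q hc'0)
          · refine mul_nonneg (Finset.prod_nonneg fun _ _ => bitWeight_nonneg _ _)
              (Finset.prod_nonneg fun _ _ => ?_)
            split_ifs <;> norm_num
      _ = (∏ c, bitWeight (x (0, c)) (b₀ c)) * ∏ c ∈ Q'.image (g b₀),
            ∑ y : Fin 3 → Bool, (∏ s : Fin 3, bitWeight (x (s.succ, c)) (y s)) *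
              (if ∃ s, y s = true then 1 else 0) := by
          rw [← Finset.mul_sum, sum_prod_mul_prod
            (fun c (y : Fin 3 → Bool) => ∏ s : Fin 3, bitWeight (x (s.succ, c)) (y s)) hW _
            (fun c (y : Fin 3 → Bool) => if ∃ s, y s = true then (1 : ℝ) else 0)]
      _ ≤ _ := by
          rw [hprod]
          refine mul_le_mul_of_nonneg_left (Finset.prod_le_prod (fun c _ => ?_) fun c _ => hall c)
            (Finset.prod_nonneg fun _ _ => bitWeight_nonneg _ _)
          refine Finset.sum_nonneg fun y _ => mul_nonneg
            (Finset.prod_nonneg fun _ _ => bitWeight_nonneg _ _) ?_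
          split_ifs <;> norm_num
  refine (Finset.sum_le_sum fun b₀ _ => hinner b₀).trans ?_
  rw [sum_prod_mul_prod (fun c b => bitWeight (x (0, c)) b) (fun c => sum_bitWeight _) Q
    (fun _ b => if b then 1 else τ), ← Finset.prod_const]
  refine Finset.prod_le_prod (fun c _ => ?_) fun c _ => ?_
  · refine Finset.sum_nonneg fun b _ => mul_nonneg (bitWeight_nonneg _ _) ?_
    split_ifs
    · exact zero_le_one
    · exact hτ0
  · have h1 := hx (0, c)
    simp only [Fintype.sum_bool, bitWeight, if_true, Bool.false_eq_true, if_false, mul_one]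
    have h2 : ((x (0, c) : unitInterval) : ℝ) * (1 - τ) ≤ p * (1 - τ) :=
      mul_le_mul_of_nonneg_right h1 (by linarith)
    have h3 : p + (1 - p) * τ = 1 - (1 - p) ^ 4 := by rw [hτ]; ring
    linarith

end Losses

section Phase

variable {n : ℕ} {M : Type*} [Fintype M] [DecidableEq M]

/-! ### The deterministic part of a phase -/

/-- The copies that are sent if the messages in `H` are held. -/
def sentCopies (H : Finset M) (k : ℕ) : Finset (Copy M k) :=
  Finset.univ.filter fun c => c.1 ∈ H

theorem mem_sentCopies {H : Finset M} {k : ℕ} {c : Copy M k} : c ∈ sentCopies H k ↔ c.1 ∈ H := by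
  simp [sentCopies]

theorem card_sentCopies (H : Finset M) (k : ℕ) : (sentCopies H k).card = H.card * k := by
  have : sentCopies H k = H ×ˢ (Finset.univ : Finset (Fin k)) := by
    ext ⟨m, j⟩
    simp [sentCopies]
  rw [this, Finset.card_product, Finset.card_univ, Fintype.card_fin]

theorem card_sentCopies_filter (H : Finset M) (k : ℕ) (P : M → Prop) [DecidablePred P] :
    ((sentCopies H k).filter fun c => P c.1).card = (H.filter P).card * k := by
  rw [← card_sentCopies]
  congr 1
  ext c
  simp [sentCopies]

/-- The copies that are forwarded in a phase. -/
def forwardedCopies (T : Task n M) (tie : TieRule n M) (st : State n M) {k : ℕ}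
    (relay : Copy M k → Fin n) (lost : Copy M k → Bool) : Finset (Copy M k) :=
  forwarded T tie st relay lost ((sentCopies st.held k).filter fun c => lost c = false)

/-- The copies the sender obtains a confirmation for in a phase. -/
def confirmedCopies (T : Task n M) (tie : TieRule n M) (st : State n M) {k : ℕ}
    (relay : Copy M k → Fin n) (lost : Fin 4 × Copy M k → Bool) : Finset (Copy M k) :=
  survivors lost 3 (survivors lost 2 (survivors lost 1
    (forwardedCopies T tie st relay fun c => lost (0, c))))

variable {T : Task n M} {tie : TieRule n M} {st : State n M} {k : ℕ} {relay : Copy M k → Fin n}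

theorem held_nextState (lost : Fin 4 × Copy M k → Bool) :
    (nextState T tie st ⟨k, relay, lost⟩).held =
      st.held \ (confirmedCopies T tie st relay lost).image Prod.fst := rfl

theorem forwardedCopies_subset (lost : Copy M k → Bool) :
    forwardedCopies T tie st relay lost ⊆ sentCopies st.held k :=
  (Finset.filter_subset _ _).trans (Finset.filter_subset _ _)

theorem mem_confirmedCopies {lost : Fin 4 × Copy M k → Bool} {c : Copy M k} :
    c ∈ confirmedCopies T tie st relay lost ↔
      c ∈ forwardedCopies T tie st relay (fun c => lost (0, c)) ∧ ∀ s : Fin 3,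
        lost (s.succ, c) = false := by
  simp only [confirmedCopies, survivors, Finset.mem_filter, and_assoc, Fin.forall_fin_succ]
  simp

theorem confirmedCopies_subset (lost : Fin 4 × Copy M k → Bool) :
    confirmedCopies T tie st relay lost ⊆ sentCopies st.held k := fun _ hc =>
  forwardedCopies_subset _ (mem_confirmedCopies.1 hc).1

theorem forwardedCopies_injOn {lost : Copy M k → Bool} {c c' : Copy M k}
    (hc : c ∈ forwardedCopies T tie st relay lost) (hc' : c' ∈ forwardedCopies T tie st relay lost)
    (hr : relay c = relay c') (hd : T.dest c.1 = T.dest c'.1) : c = c' := by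
  obtain ⟨-, h, e⟩ := Finset.mem_filter.1 hc
  obtain ⟨-, h', e'⟩ := Finset.mem_filter.1 hc'
  -- The type of the nonemptiness proof mentions the relay and the destination, so both have to
  -- become variables before the equalities can be substituted.
  revert h h' e e'
  generalize relay c = w at *
  generalize T.dest c.1 = v at *
  subst hr hd
  intro h e h' e'
  exact e.symm.trans e'

/-- The guarantee that holds for every choice rule: a copy that arrives need not be forwarded
itself, but then another one from the same relay to the same destination is. -/
theorem exists_mem_forwardedCopies {lost : Copy M k → Bool} {c : Copy M k}
    (hc : c ∈ sentCopies st.held k) (hl : lost c = false) :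
    ∃ c' ∈ forwardedCopies T tie st relay lost, relay c' = relay c ∧
      T.dest c'.1 = T.dest c.1 := by
  classical
  set A := (sentCopies st.held k).filter fun c => lost c = false with hA
  have hcA : c ∈ A := Finset.mem_filter.2 ⟨hc, hl⟩
  have hS : (A.filter fun c' => relay c' = relay c ∧ T.dest c'.1 = T.dest c.1).Nonempty :=
    ⟨c, Finset.mem_filter.2 ⟨hcA, rfl, rfl⟩⟩
  set c' := tie.choose st k relay lost (relay c) (T.dest c.1) _ hS with hc'
  have hmem := tie.choose_mem st k relay lost (relay c) (T.dest c.1) _ hS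
  rw [← hc', Finset.mem_filter] at hmem
  obtain ⟨hA', hr, hd⟩ := hmem
  refine ⟨c', ?_, hr, hd⟩
  rw [forwardedCopies, forwarded, Finset.mem_filter]
  refine ⟨hA', ?_⟩
  have key : ∀ w v, w = relay c → v = T.dest c.1 →
      ∃ hS : (A.filter fun c' => relay c' = w ∧ T.dest c'.1 = v).Nonempty,
        tie.choose st k relay lost w v _ hS = c' := by
    rintro w v rfl rfl
    exact ⟨hS, rfl⟩
  exact key _ _ hr hd

/-- A confirmed copy has in particular been received, so no message is deleted before it is
delivered. It is therefore enough to show that nothing is held at the end. -/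
theorem subset_delivered_nextState (lost : Fin 4 × Copy M k → Bool)
    (h : ∀ m, m ∉ st.held → m ∈ st.delivered) (m : M)
    (hm : m ∉ (nextState T tie st ⟨k, relay, lost⟩).held) :
    m ∈ (nextState T tie st ⟨k, relay, lost⟩).delivered := by
  rw [held_nextState, Finset.mem_sdiff, not_and_not_right] at hm
  refine Finset.mem_union.2 ?_
  by_cases hst : m ∈ st.held
  · right
    refine Finset.image_subset_image ?_ (hm hst)
    exact (Finset.filter_subset _ _).trans (Finset.filter_subset _ _)
  · exact Or.inl (h m hst)

/-- Classes of copies: the held copies of the same sender form a class. -/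
def senderClass (T : Task n M) (H : Finset M) {k : ℕ} (c : Copy M k) : Fin n ⊕ Copy M k :=
  if c.1 ∈ H then Sum.inl (T.src c.1) else Sum.inr c

theorem senderClass_eq_iff {H : Finset M} {c c' : Copy M k} (hc : c.1 ∈ H) :
    senderClass T H c' = senderClass T H c ↔ c'.1 ∈ H ∧ T.src c'.1 = T.src c.1 := by
  by_cases h : c'.1 ∈ H <;> simp [senderClass, hc, h]

/-- If some node got two copies from a sender, balance would give every node at least one, more than
`n` in total. Copies of deleted messages are singleton classes, hence unconstrained on both sides.
-/
theorem balanced_eq_classInjective {H : Finset M}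
    (hH : ∀ v, (H.filter fun m => T.src m = v).card * k ≤ n) :
    balanced T H k = classInjective (Fin n) (senderClass T H) := by
  classical
  ext relay
  rw [mem_classInjective]
  simp only [balanced, Finset.mem_filter, Finset.mem_univ, true_and]
  constructor
  · intro h c c' hcc hr
    by_cases hc : c'.1 ∈ H
    · by_contra hne
      obtain ⟨h1, h2⟩ := (senderClass_eq_iff hc).1 hcc
      set N : Fin n → ℕ := fun w => (Finset.univ.filter fun c : Copy M k =>
        c.1 ∈ H ∧ T.src c.1 = T.src c'.1 ∧ relay c = w).card with hN
      have hw : 2 ≤ N (relay c') := by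
        refine Finset.one_lt_card.2 ⟨c, ?_, c', ?_, hne⟩
        · simp [h1, h2, hr]
        · simp [hc]
      have hall : ∀ w, 1 ≤ N w := fun w => by
        have := h (T.src c'.1) (relay c') w
        have : N (relay c') ≤ N w + 1 := this
        omega
      have hsum : ∑ w, N w = (H.filter fun m => T.src m = T.src c'.1).card * k := by
        rw [← card_sentCopies_filter]
        rw [Finset.card_eq_sum_card_fiberwise (f := relay) (t := Finset.univ) (fun _ _ => by simp)]
        refine Finset.sum_congr rfl fun w _ => ?_
        simp only [hN]
        congr 1
        ext c
        simp [sentCopies, and_assoc]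
      have hlt : ∑ w : Fin n, 1 < ∑ w, N w :=
        Finset.sum_lt_sum (fun w _ => hall w) ⟨relay c', Finset.mem_univ _, hw⟩
      simp only [Finset.sum_const, Finset.card_univ, Fintype.card_fin, smul_eq_mul, mul_one] at hlt
      have := hH (T.src c'.1)
      omega
    · by_cases hc1 : c.1 ∈ H
      · simp [senderClass, hc, hc1] at hcc
      · simpa [senderClass, hc, hc1] using hcc
  · intro h v w w'
    refine le_trans (Finset.card_le_one.2 ?_) (Nat.le_add_left _ _)
    intro c hc c' hc'
    simp only [Finset.mem_filter, Finset.mem_univ, true_and] at hc hc'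
    refine h c c' ((senderClass_eq_iff hc'.1).2 ⟨hc.1, ?_⟩) (hc.2.2.trans hc'.2.2.symm)
    rw [hc.2.1, hc'.2.1]

theorem stepRounds_le_one {s : Fin 4} {S : Finset (Copy M k)}
    (h : ∀ c ∈ S, ∀ c' ∈ S, link T relay s c = link T relay s c' → c = c') :
    stepRounds T relay s S ≤ 1 := by
  refine max_le le_rfl (Finset.sup_le fun e _ => Finset.card_le_one.2 ?_)
  intro c hc c' hc'
  obtain ⟨hc, h1⟩ := Finset.mem_filter.1 hc
  obtain ⟨hc', h2⟩ := Finset.mem_filter.1 hc'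
  exact h c hc c' hc' (h1.trans h2.symm)

/-- No link carries two messages in a step: between senders and relays (steps `0` and `3`) by
injectivity on sender classes, between relays and destinations (steps `1` and `2`) because only one
copy per pair is forwarded. -/
theorem rounds_nextState_le (lost : Fin 4 × Copy M k → Bool)
    (hr : relay ∈ classInjective (Fin n) (senderClass T st.held)) :
    (nextState T tie st ⟨k, relay, lost⟩).rounds ≤ st.rounds + 4 := by
  rw [mem_classInjective] at hr
  have hsent : ∀ c ∈ sentCopies st.held k, ∀ c' ∈ sentCopies st.held k,
      T.src c.1 = T.src c'.1 → relay c = relay c' → c = c' := fun c hc c' hc' h h' =>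
    hr c c' ((senderClass_eq_iff (mem_sentCopies.1 hc')).2 ⟨mem_sentCopies.1 hc, h⟩) h'
  have h0 : stepRounds T relay 0 (sentCopies st.held k) ≤ 1 :=
    stepRounds_le_one fun c hc c' hc' h => by
      simp only [link, Prod.mk.injEq] at h
      exact hsent c hc c' hc' h.1 h.2
  set fwd := forwardedCopies T tie st relay fun c => lost (0, c) with hfwd
  have h1 : stepRounds T relay 1 fwd ≤ 1 :=
    stepRounds_le_one fun c hc c' hc' h => by
      simp only [link, Prod.mk.injEq] at h
      exact forwardedCopies_injOn hc hc' h.1 h.2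
  have h2 : stepRounds T relay 2 (survivors lost 1 fwd) ≤ 1 :=
    stepRounds_le_one fun c hc c' hc' h => by
      simp only [link, Prod.mk.injEq] at h
      exact forwardedCopies_injOn (Finset.mem_filter.1 hc).1 (Finset.mem_filter.1 hc').1 h.2 h.1
  have h3 : stepRounds T relay 3 (survivors lost 2 (survivors lost 1 fwd)) ≤ 1 :=
    stepRounds_le_one fun c hc c' hc' h => by
      simp only [link, Prod.mk.injEq] at h
      have hs : survivors lost 2 (survivors lost 1 fwd) ⊆ sentCopies st.held k :=
        ((Finset.filter_subset _ _).trans (Finset.filter_subset _ _)).trans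
          (forwardedCopies_subset _)
      exact hsent c (hs hc) c' (hs hc') h.2 h.1
  have : (nextState T tie st ⟨k, relay, lost⟩).rounds = st.rounds +
      stepRounds T relay 0 (sentCopies st.held k) + stepRounds T relay 1 fwd +
      stepRounds T relay 2 (survivors lost 1 fwd) +
      stepRounds T relay 3 (survivors lost 2 (survivors lost 1 fwd)) := rfl
  omega

/-! ### The random outcome of a phase -/

/-- The relays and the losses of phase `i`. -/
noncomputable def outcome [NeZero n] (T : Task n M)
    (q : ℕ → Fin 4 → Fin n → Fin n → unitInterval) (i k : ℕ) (st : State n M) : PMF ((Copy M k → Fin n) × (Fin 4 × Copy M k → Bool)) :=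
  (PMF.uniformOfFinset (balanced T st.held k) (balanced_nonempty T st.held k)).bind fun relay =>
    (independentBits fun e : Fin 4 × Copy M k =>
        q i e.1 (link T relay e.1 e.2).1 (link T relay e.1 e.2).2).map fun lost => (relay, lost)

theorem phase_eq_map_outcome [NeZero n] (q : ℕ → Fin 4 → Fin n → Fin n → unitInterval) (i k : ℕ) :
    phase T tie q i k st =
      (outcome T q i k st).map fun y => nextState T tie st ⟨k, y.1, y.2⟩ := by
  simp only [phase, outcome, PMF.map_bind, PMF.map_comp]
  rfl

theorem phase_toOuterMeasure [NeZero n] (q : ℕ → Fin 4 → Fin n → Fin n → unitInterval) (i : ℕ)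
    (E : Set (State n M)) : (phase T tie q i k st).toOuterMeasure E =
      (outcome T q i k st).toOuterMeasure {y | nextState T tie st ⟨k, y.1, y.2⟩ ∈ E} := by
  rw [phase_eq_map_outcome, PMF.toOuterMeasure_map_apply]
  rfl

theorem relay_mem_of_mem_support_outcome [NeZero n]
    {q : ℕ → Fin 4 → Fin n → Fin n → unitInterval} {i : ℕ}
    {y : (Copy M k → Fin n) × (Fin 4 × Copy M k → Bool)}
    (hy : y ∈ (outcome T q i k st).support) : y.1 ∈ balanced T st.held k := by
  simp only [outcome, PMF.mem_support_bind_iff, PMF.mem_support_map_iff,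
    PMF.mem_support_uniformOfFinset_iff] at hy
  obtain ⟨relay, hr, lost, -, rfl⟩ := hy
  exact hr

/-- Separates the two sources of randomness: `φ` bounds the probability over the losses for fixed
relays, and its average over the balanced distributions is a counting problem. -/
theorem outcome_toOuterMeasure_le [NeZero n] (q : ℕ → Fin 4 → Fin n → Fin n → unitInterval) (i : ℕ)
    (E : Set ((Copy M k → Fin n) × (Fin 4 × Copy M k → Bool))) (φ : (Copy M k → Fin n) → ℝ) (B : ℝ)
    (hφ0 : ∀ relay, 0 ≤ φ relay)
    (hφ : ∀ relay ∈ balanced T st.held k, (independentBits fun e : Fin 4 × Copy M k =>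
        q i e.1 (link T relay e.1 e.2).1 (link T relay e.1 e.2).2).toOuterMeasure
          {lost | (relay, lost) ∈ E} ≤ ENNReal.ofReal (φ relay))
    (hB : ∑ relay ∈ balanced T st.held k, φ relay ≤ B * (balanced T st.held k).card) :
    (outcome T q i k st).toOuterMeasure E ≤ ENNReal.ofReal B := by
  classical
  have hcard : 0 < (balanced T st.held k).card := (balanced_nonempty T st.held k).card_pos
  have hcard' : (0 : ℝ) < (balanced T st.held k).card := by exact_mod_cast hcard
  rw [outcome, PMF.toOuterMeasure_bind_apply, tsum_fintype]
  simp only [PMF.toOuterMeasure_map_apply, PMF.uniformOfFinset_apply]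
  calc _ = ∑ relay ∈ balanced T st.held k, ((balanced T st.held k).card : ℝ≥0∞)⁻¹ *
        (independentBits fun e : Fin 4 × Copy M k =>
        q i e.1 (link T relay e.1 e.2).1 (link T relay e.1 e.2).2).toOuterMeasure
          {lost | (relay, lost) ∈ E} := by
        rw [← Finset.sum_subset (Finset.subset_univ (balanced T st.held k))]
        · refine Finset.sum_congr rfl fun relay hr => ?_
          rw [if_pos hr]
          rfl
        · intro relay _ hr
          rw [if_neg hr, zero_mul]
    _ ≤ ∑ relay ∈ balanced T st.held k, ((balanced T st.held k).card : ℝ≥0∞)⁻¹ *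
          ENNReal.ofReal (φ relay) := by
        refine Finset.sum_le_sum fun relay hr => ?_
        gcongr
        exact hφ relay hr
    _ = ENNReal.ofReal ((∑ relay ∈ balanced T st.held k, φ relay) /
          (balanced T st.held k).card) := by
        rw [← Finset.mul_sum, ← ENNReal.ofReal_sum_of_nonneg fun _ _ => hφ0 _,
          ENNReal.ofReal_div_of_pos hcard', ENNReal.ofReal_natCast, ENNReal.div_eq_inv_mul]
    _ ≤ _ := by
        refine ENNReal.ofReal_le_ofReal ?_
        rwa [div_le_iff₀ hcard']

/-- For given relays, the probability that from none of given pairs of a relay and a destination,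
each with a copy at the relay for this destination, a confirmation is obtained. -/
theorem independentBits_not_confirmed_le {p : ℝ} (hp1 : p ≤ 1)
    (x : Fin 4 × Copy M k → unitInterval) (hx : ∀ e, (x e : ℝ) ≤ p) {Q : Finset (Copy M k)}
    (hQ : Q ⊆ sentCopies st.held k)
    (hQ' : ∀ c ∈ Q, ∀ c' ∈ Q, relay c = relay c' → T.dest c.1 = T.dest c'.1 → c = c')
    (E : Set (Fin 4 × Copy M k → Bool))
    (hE : ∀ lost ∈ E, ∀ c ∈ Q, ∀ c' ∈ confirmedCopies T tie st relay lost,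
      relay c' = relay c → T.dest c'.1 ≠ T.dest c.1) :
    (independentBits x).toOuterMeasure E ≤ ENNReal.ofReal ((1 - (1 - p) ^ 4) ^ Q.card) := by
  classical
  have hex : ∀ (b : Copy M k → Bool) (c : Copy M k), ∃ c', c ∈ Q → b c = false →
      c' ∈ forwardedCopies T tie st relay b ∧ relay c' = relay c ∧ T.dest c'.1 = T.dest c.1 := by
    intro b c
    by_cases h : c ∈ Q ∧ b c = false
    · obtain ⟨c', hc', h1, h2⟩ :=
        exists_mem_forwardedCopies (T := T) (tie := tie) (relay := relay) (hQ h.1) h.2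
      exact ⟨c', fun _ _ => ⟨hc', h1, h2⟩⟩
    · exact ⟨c, fun h1 h2 => absurd ⟨h1, h2⟩ h⟩
  choose g hg using hex
  refine independentBits_all_lost_le x hp1 hx Q E g ?_ ?_
  · rintro b c ⟨hc, hb⟩ c' ⟨hc', hb'⟩ h
    obtain ⟨-, h1, h2⟩ := hg b c hc hb
    obtain ⟨-, h1', h2'⟩ := hg b c' hc' hb'
    refine hQ' c hc c' hc' ?_ ?_
    · rw [← h1, ← h1', h]
    · rw [← h2, ← h2', h]
  · intro b hb c hc hbc
    obtain ⟨h0, h1, h2⟩ := hg (fun c => b (0, c)) c hc hbc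
    by_contra! h
    refine hE b hb c hc _ (mem_confirmedCopies.2 ⟨h0, fun s => ?_⟩) h1 h2
    simpa using h s

end Phase

section Phase

variable {n : ℕ} [NeZero n] {M : Type*} [Fintype M] [DecidableEq M] {T : Task n M}
  {tie : TieRule n M} {st : State n M} {k : ℕ}

/-! ### Probabilistic bounds for one phase -/

/-- The probability that all messages in `S` are still held after a phase. The set `D` has to
contain all other copies that can get in the way of a copy of a message in `S`. -/
theorem outcome_subset_held_le {p b m l a : ℝ} (hp1 : p ≤ 1)
    {q : ℕ → Fin 4 → Fin n → Fin n → unitInterval} {i : ℕ} (hq : ∀ s u w, (q i s u w : ℝ) ≤ p)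
    (hload : ∀ v, (st.held.filter fun m => T.src m = v).card * k ≤ n) {S : Finset M}
    (hS : S ⊆ st.held) {D : Finset (Copy M k)}
    (hDS : Disjoint D (sentCopies S k))
    (hclosed : ∀ c ∈ sentCopies st.held k, c ∉ D → c.1 ∉ S → ∀ c' ∈ sentCopies S k,
      T.dest c.1 = T.dest c'.1 → T.src c.1 = T.src c'.1)
    (hb0 : 0 < b) (hb1 : b ≤ 1) (hbp : 1 - (1 - p) ^ 4 ≤ b) (ha : ((S.card * k : ℕ) : ℝ) ≤ a)
    (hm : ∀ x ∈ S, ((D.filter fun c => T.dest c.1 = T.dest x).card : ℝ) ≤ m)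
    (hl : ∀ x ∈ S, (((D ∪ sentCopies S k).filter fun c => T.src c.1 = T.src x).card : ℝ) ≤ l)
    (hln : l < n) :
    (outcome T q i k st).toOuterMeasure
        {y | S ⊆ (nextState T tie st ⟨k, y.1, y.2⟩).held} ≤
      ENNReal.ofReal ((b + (1 - b) * ((m + a) / (n - l)) + (1 / b - 1) * (a / (n - l))) ^
        (S.card * k)) := by
  classical
  set A := sentCopies S k with hA
  have hAsent : A ⊆ sentCopies st.held k := fun c hc => by
    rw [mem_sentCopies] at *; exact hS hc
  have hp0 : (0 : ℝ) ≤ 1 - (1 - p) ^ 4 := by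
    have h0 := (q i 0 0 0).2.1.trans (hq 0 0 0)
    have : (1 - p) ^ 4 ≤ 1 := pow_le_one₀ (by linarith) (by linarith)
    linarith
  refine outcome_toOuterMeasure_le q i _
    (fun relay => b ^ (alone (fun c : Copy M k => T.dest c.1) (D ∪ A) A relay).card) _
    (fun _ => by positivity) ?_ ?_
  · intro relay hrelay
    rw [balanced_eq_classInjective hload, mem_classInjective] at hrelay
    refine (independentBits_not_confirmed_le (T := T) (tie := tie) (st := st) (relay := relay) hp1 _
      (fun e => hq _ _ _) (Q := alone (fun c : Copy M k => T.dest c.1) (D ∪ A) A relay)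
      ?_ ?_ _ ?_).trans (ENNReal.ofReal_le_ofReal (pow_le_pow_left₀ hp0 hbp _))
    · exact fun c hc => hAsent (mem_alone.1 hc).1
    · intro c hc c' hc' hr hd
      exact (mem_alone.1 hc').2 c (Finset.mem_union_right _ (mem_alone.1 hc).1) hd hr
    · intro lost hlost c hc c' hc' hr hd
      obtain ⟨hcA, hal⟩ := mem_alone.1 hc
      have hc's := confirmedCopies_subset _ hc'
      -- A copy confirmed via the relay and destination of a lone `c` is `c` itself: inside `D ∪ A`
      -- by loneness; outside, `hclosed` gives it the same sender, and injectivity applies.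
      have hcc : c' = c := by
        by_cases h : c' ∈ D ∪ A
        · exact hal c' h hd hr
        · rw [Finset.mem_union, not_or] at h
          refine hrelay c' c ?_ hr
          rw [senderClass_eq_iff (mem_sentCopies.1 (hAsent hcA))]
          refine ⟨mem_sentCopies.1 hc's, hclosed c' hc's h.1 ?_ c hcA hd⟩
          exact fun h' => h.2 (mem_sentCopies.2 h')
      subst hcc
      have h1 : c'.1 ∈ (nextState T tie st ⟨k, relay, lost⟩).held :=
        hlost (mem_sentCopies.1 hcA)
      rw [held_nextState, Finset.mem_sdiff] at h1
      exact h1.2 (Finset.mem_image_of_mem _ hc')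
  · rw [balanced_eq_classInjective hload, ← card_sentCopies]
    have := sum_pow_card_alone_le (B := Fin n) (senderClass T st.held)
      (fun c : Copy M k => T.dest c.1) hDS hb0 hb1 (a := a) (m := m) (l := l)
      (by rwa [card_sentCopies]) (fun x hx => hm x.1 (mem_sentCopies.1 hx)) (fun x hx => ?_)
      (by rwa [Fintype.card_fin])
    · rwa [Fintype.card_fin] at this
    · refine le_trans ?_ (hl x.1 (mem_sentCopies.1 hx))
      refine Nat.cast_le.2 (Finset.card_le_card fun c hc => ?_)
      rw [Finset.mem_filter, senderClass_eq_iff (mem_sentCopies.1 (hAsent hx))] at hc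
      exact Finset.mem_filter.2 ⟨hc.1, hc.2.2⟩

/-- The relays that do not pass on any confirmation from `v`. -/
def silentRelays (T : Task n M) (tie : TieRule n M) (st : State n M)
    (y : (Copy M k → Fin n) × (Fin 4 × Copy M k → Bool)) (v : Fin n) : Finset (Fin n) :=
  Finset.univ.filter fun w => ∀ c ∈ confirmedCopies T tie st y.1 y.2, y.1 c = w → T.dest c.1 ≠ v

/-- A relay reached by some copy for `v` is silent only because of losses. One copy is chosen per
such relay in `W`, and the number of these relays is averaged by `sum_pow_card_hit_le`. Collisions
are harmless, so no bound on the destination load is needed. -/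
theorem outcome_subset_silentRelays_le {p : ℝ} (hp1 : p ≤ 1)
    {q : ℕ → Fin 4 → Fin n → Fin n → unitInterval} {i : ℕ} (hq : ∀ s u w, (q i s u w : ℝ) ≤ p)
    (hload : ∀ v, (st.held.filter fun m => T.src m = v).card * k ≤ n) (v : Fin n)
    (W : Finset (Fin n)) :
    (outcome T q i k st).toOuterMeasure {y | W ⊆ silentRelays T tie st y v} ≤
      ENNReal.ofReal ((1 - (1 - p) ^ 4 * (1 - Real.exp
        (-(((st.held.filter fun m => T.dest m = v).card * k : ℕ) / n)))) ^ W.card) := by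
  classical
  set D := (sentCopies st.held k).filter fun c => T.dest c.1 = v with hD
  have h0 := (q i 0 0 0).2.1.trans (hq 0 0 0)
  have hδ1 : (1 - p) ^ 4 ≤ 1 := pow_le_one₀ (by linarith) (by linarith)
  have hδ0 : 0 ≤ (1 - p) ^ 4 := pow_nonneg (by linarith) _
  refine outcome_toOuterMeasure_le q i _
    (fun relay => (1 - (1 - p) ^ 4) ^ (W.filter fun w => ∃ c ∈ D, relay c = w).card) _
    (fun _ => pow_nonneg (by linarith) _) ?_ ?_
  · intro relay hrelay
    set W' := W.filter fun w => ∃ c ∈ D, relay c = w with hW'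
    have hex : ∀ w : W', ∃ c ∈ D, relay c = w := fun w => (Finset.mem_filter.1 w.2).2
    choose g hgD hg using hex
    have hinj : Function.Injective g := fun w w' h => by
      apply Subtype.ext
      rw [← hg w, ← hg w', h]
    have hcard : (Finset.univ.image g).card = W'.card := by
      rw [Finset.card_image_of_injective _ hinj, Finset.card_univ, Fintype.card_coe]
    rw [← hcard]
    refine independentBits_not_confirmed_le (T := T) (tie := tie) (st := st) (relay := relay) hp1 _
      (fun e => hq _ _ _) ?_ ?_ _ ?_
    · intro c hc
      obtain ⟨w, -, rfl⟩ := Finset.mem_image.1 hc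
      exact (Finset.mem_filter.1 (hgD w)).1
    · intro c hc c' hc' hr _
      obtain ⟨w, -, rfl⟩ := Finset.mem_image.1 hc
      obtain ⟨w', -, rfl⟩ := Finset.mem_image.1 hc'
      rw [hg, hg] at hr
      rw [Subtype.ext hr]
    · intro lost hlost c hc c' hc' hr hd
      obtain ⟨w, -, rfl⟩ := Finset.mem_image.1 hc
      have hw : (w : Fin n) ∈ silentRelays T tie st (relay, lost) v :=
        hlost (Finset.mem_filter.1 w.2).1
      refine (Finset.mem_filter.1 hw).2 c' hc' (hr.trans (hg w)) (hd.trans ?_)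
      exact (Finset.mem_filter.1 (hgD w)).2
  · rw [balanced_eq_classInjective hload, ← card_sentCopies_filter]
    have := sum_pow_card_hit_le (B := Fin n) (senderClass T st.held) W D hδ0 hδ1
    rwa [Fintype.card_fin] at this

/-- If only one copy of each message is made, every relay that is not silent relieves the senders of
a message for `v`. -/
theorem card_held_nextState_add_le (v : Fin n)
    (y : (Copy M 1 → Fin n) × (Fin 4 × Copy M 1 → Bool)) :
    ((nextState T tie st ⟨1, y.1, y.2⟩).held.filter fun m => T.dest m = v).card + n ≤
      (st.held.filter fun m => T.dest m = v).card + (silentRelays T tie st y v).card := by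
  classical
  set K := (confirmedCopies T tie st y.1 y.2).filter fun c => T.dest c.1 = v with hK
  have h1 : n ≤ K.card + (silentRelays T tie st y v).card := by
    have : (Finset.univ : Finset (Fin n)) ⊆ K.image y.1 ∪ silentRelays T tie st y v := by
      intro w _
      rw [Finset.mem_union, or_iff_not_imp_right]
      intro hw
      simp only [silentRelays, Finset.mem_filter, Finset.mem_univ, true_and] at hw
      push Not at hw
      obtain ⟨c, hc, hcw, hcv⟩ := hw
      exact Finset.mem_image.2 ⟨c, Finset.mem_filter.2 ⟨hc, hcv⟩, hcw⟩
    have h := (Finset.card_le_card this).trans (Finset.card_union_le _ _)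
    rw [Finset.card_univ, Fintype.card_fin] at h
    exact h.trans (Nat.add_le_add_right Finset.card_image_le _)
  -- With a single copy per message, distinct confirmed copies belong to distinct messages.
  have hinj : Set.InjOn Prod.fst (K : Set (Copy M 1)) := fun c _ c' _ h =>
    Prod.ext h (Subsingleton.elim _ _)
  have h2 : ((nextState T tie st ⟨1, y.1, y.2⟩).held.filter fun m => T.dest m = v).card + K.card ≤
      (st.held.filter fun m => T.dest m = v).card := by
    rw [← Finset.card_image_of_injOn hinj, ← Finset.card_union_of_disjoint]
    · refine Finset.card_le_card (Finset.union_subset ?_ ?_)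
      · exact Finset.filter_subset_filter _ Finset.sdiff_subset
      · intro m hm
        obtain ⟨c, hc, rfl⟩ := Finset.mem_image.1 hm
        obtain ⟨hc1, hc2⟩ := Finset.mem_filter.1 hc
        exact Finset.mem_filter.2 ⟨mem_sentCopies.1 (confirmedCopies_subset _ hc1), hc2⟩
    · rw [Finset.disjoint_left]
      intro m hm hm'
      obtain ⟨c, hc, rfl⟩ := Finset.mem_image.1 hm'
      have := (Finset.mem_filter.1 hm).1
      rw [held_nextState, Finset.mem_sdiff] at this
      exact this.2 (Finset.mem_image_of_mem _ (Finset.mem_filter.1 hc).1)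
  omega

/-- A state in which every node still holds at most `x` messages and is the destination of at most
`y` of the messages that are still held, reached within four rounds for each of `i` phases. -/
structure Good (T : Task n M) (x y : ℝ) (i : ℕ) (st : State n M) : Prop where
  src_le : ∀ v, ((st.held.filter fun m => T.src m = v).card : ℝ) ≤ x
  dest_le : ∀ v, ((st.held.filter fun m => T.dest m = v).card : ℝ) ≤ y
  rounds_le : st.rounds ≤ 4 * i
  delivered : ∀ m, m ∉ st.held → m ∈ st.delivered

/-- A union bound over the `2 * n` counts. The round count and the delivery invariant hold on the
whole support and cost no probability. -/
theorem phase_not_good_le {q : ℕ → Fin 4 → Fin n → Fin n → unitInterval} {i t : ℕ}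
    {x y x' y' e : ℝ}
    (hgood : Good T x y t st) (hload : ∀ v, (st.held.filter fun m => T.src m = v).card * k ≤ n)
    (hsrc : ∀ v, (outcome T q i k st).toOuterMeasure {ω | x' <
      (((nextState T tie st ⟨k, ω.1, ω.2⟩).held.filter fun m => T.src m = v).card : ℝ)} ≤
        ENNReal.ofReal e)
    (hdest : ∀ v, (outcome T q i k st).toOuterMeasure {ω | y' <
      (((nextState T tie st ⟨k, ω.1, ω.2⟩).held.filter fun m => T.dest m = v).card : ℝ)} ≤
        ENNReal.ofReal e) :
    (phase T tie q i k st).toOuterMeasure {st' | Good T x' y' (t + 1) st'}ᶜ ≤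
      ENNReal.ofReal (2 * n * e) := by
  classical
  rw [phase_toOuterMeasure]
  set Es : Fin n → Set ((Copy M k → Fin n) × (Fin 4 × Copy M k → Bool)) := fun v => {ω | x' <
      (((nextState T tie st ⟨k, ω.1, ω.2⟩).held.filter fun m => T.src m = v).card : ℝ)} with hEs
  set Ed : Fin n → Set ((Copy M k → Fin n) × (Fin 4 × Copy M k → Bool)) := fun v => {ω | y' <
      (((nextState T tie st ⟨k, ω.1, ω.2⟩).held.filter fun m => T.dest m = v).card : ℝ)} with hEd
  have hsub : (outcome T q i k st).toOuterMeasure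
      {ω | nextState T tie st ⟨k, ω.1, ω.2⟩ ∈ {st' | Good T x' y' (t + 1) st'}ᶜ} ≤
      (outcome T q i k st).toOuterMeasure
        ((⋃ v ∈ (Finset.univ : Finset (Fin n)), Es v) ∪
          ⋃ v ∈ (Finset.univ : Finset (Fin n)), Ed v) := by
    refine PMF.toOuterMeasure_mono _ ?_
    rintro ω ⟨hω, hsupp⟩
    by_contra hnot
    simp only [Finset.mem_univ, Set.iUnion_true, Set.mem_union, Set.mem_iUnion, hEs, hEd,
      Set.mem_ofPred_eq, not_or, not_exists, not_lt] at hnot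
    refine hω ⟨fun v => hnot.1 v, fun v => hnot.2 v, ?_, ?_⟩
    · have h1 := relay_mem_of_mem_support_outcome hsupp
      rw [balanced_eq_classInjective hload] at h1
      have := rounds_nextState_le (tie := tie) ω.2 h1
      have := hgood.rounds_le
      omega
    · exact subset_delivered_nextState ω.2 hgood.delivered
  refine hsub.trans ((MeasureTheory.measure_union_le _ _).trans ?_)
  refine (add_le_add (toOuterMeasure_biUnion_le _ _ _ fun v _ => hsrc v)
    (toOuterMeasure_biUnion_le _ _ _ fun v _ => hdest v)).trans_eq ?_
  rw [Finset.card_univ, Fintype.card_fin, ← two_mul, ← mul_assoc,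
    ENNReal.ofReal_mul (by positivity), ENNReal.ofReal_mul (by positivity),
    ENNReal.ofReal_natCast, ENNReal.ofReal_ofNat]

end Phase

section Phase

variable {n : ℕ} [NeZero n] {M : Type*} [Fintype M] [DecidableEq M] {T : Task n M}
  {tie : TieRule n M} {st : State n M}

/-! ### Phases with few copies -/

/-- By convexity the exponential lies below its chord, whose slope involves `1 - 1 / e > 5 / 8`. -/
theorem mul_le_one_sub_exp_neg {t : ℝ} (h0 : 0 ≤ t) (h1 : t ≤ 1) :
    5 / 8 * t ≤ 1 - Real.exp (-t) := by
  have h := convexOn_exp.2 (Set.mem_univ 0) (Set.mem_univ (-1 : ℝ)) (sub_nonneg.2 h1) h0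
    (by ring)
  simp only [smul_eq_mul, mul_zero, zero_add, mul_neg, mul_one, Real.exp_zero] at h
  have he : Real.exp (-1) ≤ 3 / 8 := by
    rw [Real.exp_neg, inv_le_comm₀ (Real.exp_pos _) (by norm_num)]
    have := Real.exp_one_gt_d9
    norm_num at this ⊢
    linarith
  nlinarith

/-- An estimate of the base in `outcome_subset_held_le` if only few copies are considered. -/
theorem collision_factor_le {b δ τ ε y n j : ℝ} (hb : b = 1 - δ + τ) (hb1 : b ≤ 1) (hb0 : 0 < b)
    (hτ0 : 0 < τ) (hτε : τ ≤ ε / 8) (hy0 : 0 ≤ y) (hy1 : y ≤ 1) (hjn : j < n)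
    (hj0 : 0 ≤ j) (hj1 : (2 + 1 / τ) * (j / (n - j)) ≤ ε / 8) (hδ1 : δ ≤ 1) :
    b + (1 - b) * ((y * n + j) / (n - j)) + (1 / b - 1) * (j / (n - j)) ≤
      1 - δ * (1 - y) + ε / 4 := by
  have hnj : 0 < n - j := by linarith
  set η : ℝ := j / (n - j) with hη
  have hη0 : 0 ≤ η := by positivity
  have h0 : (y * n + j) / (n - j) = y + (y + 1) * η := by
    rw [hη]; field_simp; ring
  have h1 : (y * n + j) / (n - j) ≤ y + 2 * η := by
    rw [h0]
    have : (y + 1) * η ≤ 2 * η := mul_le_mul_of_nonneg_right (by linarith) hη0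
    linarith
  have h2 : 1 / b ≤ 1 / τ := one_div_le_one_div_of_le hτ0 (by linarith)
  have h3 : (1 - b) * ((y * n + j) / (n - j)) ≤ (1 - b) * (y + 2 * η) :=
    mul_le_mul_of_nonneg_left h1 (by linarith)
  have h4 : (1 / b - 1) * η ≤ 1 / τ * η := mul_le_mul_of_nonneg_right (by linarith) hη0
  have h5 : (1 - b) * (2 * η) ≤ 1 * (2 * η) :=
    mul_le_mul_of_nonneg_right (by linarith) (by linarith)
  have h6 : (2 + 1 / τ) * η = 2 * η + 1 / τ * η := by ring
  have h7 : (1 - b) * (y + 2 * η) = (1 - b) * y + (1 - b) * (2 * η) := by ring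
  have h8 : b + (1 - b) * y = 1 - δ * (1 - y) + τ * (1 - y) := by rw [hb]; ring
  have h9 : τ * (1 - y) ≤ τ * 1 := mul_le_mul_of_nonneg_left (by linarith) hτ0.le
  linarith

/-- Bounds the base of the factorial moment estimate away from one. The slack `ε` in `u'` has to
absorb both the error `ε / 4` of `γ` and the loss of `j` in the denominator. -/
theorem survival_ratio_le {γ u A ε n j u' Δ : ℝ} (hn0 : 0 < n) (hu0 : 0 ≤ u) (hu1 : u ≤ 1)
    (hε : 0 < ε) (hA0 : 0 ≤ A) (hA1 : A ≤ 1) (hA : A = u * Δ) (hγ : γ ≤ Δ + ε / 4)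
    (hj : j ≤ ε / 2 * n) (hu' : A + ε ≤ u') :
    γ * (u * n) / (u' * n - j) ≤ (1 + ε / 4) / (1 + ε / 2) := by
  have h0 : (A + ε) * n ≤ u' * n := mul_le_mul_of_nonneg_right hu' hn0.le
  have h1 : (A + ε / 2) * n ≤ u' * n - j := by linarith
  have hpos : 0 < (A + ε / 2) * n := by positivity
  have h2 : γ * u ≤ A + ε / 4 := by
    have h3 : γ * u ≤ (Δ + ε / 4) * u := mul_le_mul_of_nonneg_right hγ hu0
    have h4 : ε / 4 * u ≤ ε / 4 * 1 := mul_le_mul_of_nonneg_left hu1 (by linarith)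
    linarith
  rw [div_le_div_iff₀ (by linarith) (by linarith)]
  have h3 : γ * u * (n * (1 + ε / 2)) ≤ (A + ε / 4) * (n * (1 + ε / 2)) :=
    mul_le_mul_of_nonneg_right h2 (by positivity)
  have h4 : (1 + ε / 4) * ((A + ε / 2) * n) ≤ (1 + ε / 4) * (u' * n - j) :=
    mul_le_mul_of_nonneg_left h1 (by positivity)
  have h5 : (A + ε / 4) * (1 + ε / 2) ≤ (1 + ε / 4) * (A + ε / 2) := by
    have : A * ε ≤ 1 * ε := mul_le_mul_of_nonneg_right hA1 hε.le
    linarith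
  have h6 := mul_le_mul_of_nonneg_right h5 hn0.le
  linarith

/-- The effect of a phase with a single copy of each message on the messages of one sender. -/
theorem outcome_src_le_of_single {p δ τ ε u y u' : ℝ} (hp1 : p < 1) (hδ : δ = (1 - p) ^ 4)
    {q : ℕ → Fin 4 → Fin n → Fin n → unitInterval} {i t j : ℕ} (hq : ∀ s u w, (q i s u w : ℝ) ≤ p)
    (hgood : Good T (u * n) (y * n) t st) (hu0 : 0 ≤ u) (hu1 : u ≤ 1) (hy0 : 0 ≤ y) (hy1 : y ≤ 1)
    (hε : 0 < ε) (hτ0 : 0 < τ) (hτδ : τ ≤ δ) (hτε : τ ≤ ε / 8)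
    (hjn : j < n) (hj1 : (2 + 1 / τ) * (j / (n - j)) ≤ ε / 8) (hj2 : (j : ℝ) ≤ ε / 2 * n)
    (hu' : u * (1 - δ * (1 - y)) + ε ≤ u') (v : Fin n) :
    (outcome T q i 1 st).toOuterMeasure {ω | u' * n ≤
      (((nextState T tie st ⟨1, ω.1, ω.2⟩).held.filter fun m => T.src m = v).card : ℝ)} ≤
        ENNReal.ofReal (((1 + ε / 4) / (1 + ε / 2)) ^ j) := by
  classical
  have hn0 : (0 : ℝ) < n := by exact_mod_cast Nat.pos_of_ne_zero (NeZero.ne n)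
  have hjn' : (j : ℝ) < n := by exact_mod_cast hjn
  have hnj : 0 < (n : ℝ) - j := by linarith
  have hp0 : 0 ≤ p := (q i 0 0 0).2.1.trans (hq 0 0 0)
  have hδ0 : 0 < δ :=
    hδ ▸ pow_pos (sub_pos.2 hp1) 4
  have hδ1 : δ ≤ 1 := by rw [hδ]; exact pow_le_one₀ (by linarith) (by linarith)
  have hload : ∀ v, (st.held.filter fun m => T.src m = v).card * 1 ≤ n := fun v => by
    rw [mul_one]
    have h := hgood.src_le v
    have : u * n ≤ 1 * n := by gcongr
    rw [one_mul] at this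
    exact_mod_cast h.trans this
  -- The slack `τ` keeps `b` away from zero even if nothing is ever lost, that is, for `δ = 1`.
  set b := 1 - δ + τ with hb
  have hb0 : 0 < b := by linarith
  have hb1 : b ≤ 1 := by linarith
  set A := u * (1 - δ * (1 - y)) with hA
  have hq0 : 0 ≤ 1 - δ * (1 - y) := by nlinarith
  have hq1 : 1 - δ * (1 - y) ≤ 1 := by nlinarith
  have hA0 : 0 ≤ A := mul_nonneg hu0 hq0
  have hA1 : A ≤ 1 := mul_le_one₀ hu1 hq0 hq1
  set η : ℝ := j / (n - j) with hη
  have hη0 : 0 ≤ η := by positivity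
  set γ := b + (1 - b) * ((y * n + j) / (n - j)) + (1 / b - 1) * (j / (n - j)) with hγ
  have hbb : 0 ≤ 1 / b - 1 := by rw [sub_nonneg, le_div_iff₀ hb0]; linarith
  have hγ0 : 0 ≤ γ := by
    have : 0 ≤ 1 - b := by linarith
    positivity
  have hγle : γ ≤ 1 - δ * (1 - y) + ε / 4 :=
    collision_factor_le hb hb1 hb0 hτ0 hτε hy0 hy1 hjn' (Nat.cast_nonneg j) hj1 hδ1
  have hσ : (j : ℝ) < u' * n := by
    have h1 : (A + ε) * n ≤ u' * n := by gcongr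
    have h2 : ε / 2 * n < (A + ε) * n := by
      have : ε / 2 < A + ε := by linarith
      gcongr
    linarith
  have htail := toOuterMeasure_card_ge_le (outcome T q i 1 st)
    (fun ω => (nextState T tie st ⟨1, ω.1, ω.2⟩).held.filter fun m => T.src m = v)
    (st.held.filter fun m => T.src m = v)
    (fun ω => Finset.filter_subset_filter _ Finset.sdiff_subset) hγ0 (hgood.src_le v) hσ ?_
  · refine htail.trans (ENNReal.ofReal_le_ofReal (pow_le_pow_left₀ ?_ ?_ _))
    · have : 0 < u' * n - j := by linarith
      positivity
    · exact survival_ratio_le hn0 hu0 hu1 hε hA0 hA1 hA hγle hj2 hu'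
  · intro S hS
    obtain ⟨hSU, hSj⟩ := Finset.mem_powersetCard.1 hS
    have hSv : ∀ m ∈ S, T.src m = v := fun m hm => (Finset.mem_filter.1 (hSU hm)).2
    have hSH : S ⊆ st.held := hSU.trans (Finset.filter_subset _ _)
    -- Copies of `v` outside `S` are left out of `D`, since injectivity already prevents them from
    -- meeting those in `S`. Only `j` copies of the sender are then revealed, which keeps the
    -- denominator at `n - j` although `v` may have `n` copies.
    have h := outcome_subset_held_le (T := T) (tie := tie) (b := b) (m := y * n) (l := j) (a := j)
      hp1.le hq hload hSH (D := (sentCopies st.held 1).filter fun c => T.src c.1 ≠ v)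
      ?_ ?_ hb0 hb1 (by rw [← hδ]; linarith) ?_ ?_ ?_ hjn'
    · rw [hSj, mul_one] at h
      refine le_trans (PMF.toOuterMeasure_mono _ fun ω hω => ?_) h
      exact subset_trans (α := Finset M) hω.1 (Finset.filter_subset _ _)
    · rw [Finset.disjoint_left]
      intro c hc hc'
      exact (Finset.mem_filter.1 hc).2 (hSv _ (mem_sentCopies.1 hc'))
    · intro c hc hcD _ c' hc' _
      rw [hSv _ (mem_sentCopies.1 hc')]
      by_contra hne
      exact hcD (Finset.mem_filter.2 ⟨hc, hne⟩)
    · rw [hSj, mul_one]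
    · intro m _
      refine le_trans ?_ (hgood.dest_le (T.dest m))
      refine Nat.cast_le.2 ?_
      rw [← mul_one (Finset.card (st.held.filter _)), ← card_sentCopies_filter]
      exact Finset.card_le_card (Finset.filter_subset_filter _ (Finset.filter_subset _ _))
    · intro m hm
      refine Nat.cast_le.2 ?_
      rw [← hSj, ← mul_one S.card, ← card_sentCopies]
      refine Finset.card_le_card fun c hc => ?_
      obtain ⟨hc1, hc2⟩ := Finset.mem_filter.1 hc
      rcases Finset.mem_union.1 hc1 with h | h
      · exact absurd (hc2.trans (hSv m hm)) (Finset.mem_filter.1 h).2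
      · exact h

/-- The effect of a phase with a single copy of each message on the messages for one node. -/
theorem outcome_dest_le_of_single {p δ ε u y y' : ℝ} (hp1 : p < 1) (hδ : δ = (1 - p) ^ 4)
    {q : ℕ → Fin 4 → Fin n → Fin n → unitInterval} {i t j : ℕ} (hq : ∀ s u w, (q i s u w : ℝ) ≤ p)
    (hgood : Good T (u * n) (y * n) t st) (hu1 : u ≤ 1) (hy1 : y ≤ 1)
    (hε : 0 < ε) (hj2 : (j : ℝ) ≤ ε / 2 * n)
    (hy' : y * (1 - 5 / 8 * δ) + ε ≤ y') (v : Fin n) :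
    (outcome T q i 1 st).toOuterMeasure {ω | y' * n ≤
      (((nextState T tie st ⟨1, ω.1, ω.2⟩).held.filter fun m => T.dest m = v).card : ℝ)} ≤
        ENNReal.ofReal (((1 + ε / 4) / (1 + ε / 2)) ^ j) := by
  classical
  have hn0 : (0 : ℝ) < n := by exact_mod_cast Nat.pos_of_ne_zero (NeZero.ne n)
  have hp0 : 0 ≤ p := (q i 0 0 0).2.1.trans (hq 0 0 0)
  have hδ0 : 0 < δ :=
    hδ ▸ pow_pos (sub_pos.2 hp1) 4
  have hδ1 : δ ≤ 1 := by rw [hδ]; exact pow_le_one₀ (by linarith) (by linarith)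
  have hload : ∀ v, (st.held.filter fun m => T.src m = v).card * 1 ≤ n := fun v => by
    rw [mul_one]
    have h := hgood.src_le v
    have : u * n ≤ 1 * n := by gcongr
    rw [one_mul] at this
    exact_mod_cast h.trans this
  set H := (st.held.filter fun m => T.dest m = v).card with hH
  set z : ℝ := H / n with hz
  have hz0 : 0 ≤ z := by positivity
  have hHz : (H : ℝ) = z * n := by rw [hz]; field_simp
  have hzy : z ≤ y := by
    rw [hz, div_le_iff₀ hn0]; exact hgood.dest_le v
  set ρ := 1 - δ * (1 - Real.exp (-z)) with hρ
  have he1 : Real.exp (-z) ≤ 1 := Real.exp_le_one_iff.2 (by linarith)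
  have he0 : 0 < Real.exp (-z) := Real.exp_pos _
  have hρ0 : 0 ≤ ρ := by nlinarith
  have hρ1 : ρ ≤ 1 := by nlinarith
  have hσ : (j : ℝ) < (ρ + ε) * n := by
    have : ε / 2 * n < (ρ + ε) * n := by
      have : ε / 2 < ρ + ε := by linarith
      gcongr
    linarith
  -- The moment method is applied to the silent relays, not to the messages: those for `v` may be so
  -- many that few are without collision.
  have htail := toOuterMeasure_card_ge_le (outcome T q i 1 st)
    (fun ω => silentRelays T tie st ω v) Finset.univ (fun ω => Finset.subset_univ _) hρ0
    (h := n) (by simp) hσ (j := j) ?_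
  · refine le_trans (PMF.toOuterMeasure_mono _ ?_)
      (htail.trans (ENNReal.ofReal_le_ofReal (pow_le_pow_left₀ ?_ ?_ _)))
    · rintro ω ⟨hω, -⟩
      have h1 := card_held_nextState_add_le (T := T) (tie := tie) (st := st) v ω
      have h2 : ((((nextState T tie st ⟨1, ω.1, ω.2⟩).held.filter fun m => T.dest m = v).card : ℕ)
          : ℝ) + n ≤ z * n + ((silentRelays T tie st ω v).card : ℝ) := by
        rw [← hHz]; exact_mod_cast h1
      have h3 : y' * n ≤ (((nextState T tie st ⟨1, ω.1, ω.2⟩).held.filter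
        fun m => T.dest m = v).card : ℝ) := hω
      have h4 := mul_le_one_sub_exp_neg hz0 (hzy.trans hy1)
      have h5 : z - δ * (1 - Real.exp (-z)) ≤ y * (1 - 5 / 8 * δ) := by
        have : z * (1 - 5 / 8 * δ) ≤ y * (1 - 5 / 8 * δ) := by
          apply mul_le_mul_of_nonneg_right hzy; linarith
        nlinarith
      have h6 : (z + ρ - 1 + ε) * n ≤ y' * n := by
        apply mul_le_mul_of_nonneg_right _ hn0.le
        rw [hρ]; linarith
      change (ρ + ε) * n ≤ ((silentRelays T tie st ω v).card : ℝ)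
      linarith
    · have : 0 < (ρ + ε) * n - j := by linarith
      positivity
    · rw [div_le_div_iff₀ (by linarith) (by linarith)]
      have h1 : (1 + ε / 4) * ((ρ + ε / 2) * n) ≤ (1 + ε / 4) * ((ρ + ε) * n - j) := by
        gcongr
        linarith
      refine le_trans ?_ h1
      have h2 : ρ * (1 + ε / 2) ≤ (1 + ε / 4) * (ρ + ε / 2) := by nlinarith
      nlinarith
  · intro S hS
    have h := outcome_subset_silentRelays_le (T := T) (tie := tie) hp1.le hq hload v S
    rwa [mul_one, ← hH, ← hδ, ← hz, ← hρ, (Finset.mem_powersetCard.1 hS).2] at h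

/-! ### Phases with low load -/

/-- If every node has to send at most `n / 3` copies and at most `n / 4` copies are destined to it,
then the probability that all messages in a small set are still held after the phase decreases
exponentially in their number. -/
theorem outcome_subset_held_le_exp {p δ : ℝ} (hp1 : p < 1) (hδ : δ = (1 - p) ^ 4)
    {q : ℕ → Fin 4 → Fin n → Fin n → unitInterval} {i k : ℕ} (hq : ∀ s u w, (q i s u w : ℝ) ≤ p)
    (hsrc : ∀ v, ((st.held.filter fun m => T.src m = v).card : ℝ) * k ≤ n / 3)
    (hdest : ∀ v, ((st.held.filter fun m => T.dest m = v).card : ℝ) * k ≤ n / 4)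
    {S : Finset M} (hS : S ⊆ st.held) (hSk : (S.card : ℝ) * k ≤ n / 200) :
    (outcome T q i k st).toOuterMeasure
        {y | S ⊆ (nextState T tie st ⟨k, y.1, y.2⟩).held} ≤
      ENNReal.ofReal (Real.exp (-(3 / 10 * δ * k)) ^ S.card) := by
  classical
  have hn0 : (0 : ℝ) < n := by exact_mod_cast Nat.pos_of_ne_zero (NeZero.ne n)
  have hp0 : 0 ≤ p := (q i 0 0 0).2.1.trans (hq 0 0 0)
  have hδ0 : 0 < δ :=
    hδ ▸ pow_pos (sub_pos.2 hp1) 4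
  have hδ1 : δ ≤ 1 := by rw [hδ]; exact pow_le_one₀ (by linarith) (by linarith)
  have hload : ∀ v, (st.held.filter fun m => T.src m = v).card * k ≤ n := fun v => by
    have h := (hsrc v).trans (by linarith : (n : ℝ) / 3 ≤ n)
    exact_mod_cast h
  -- All other held copies go into `D`. As `1 / b - 1 ≤ δ`, the base is at most `1 - δ / 2 + δ / 2 *
  -- (153 / 400) + δ * (3 / 400) = 1 - 241 / 800 * δ`, just below `1 - 3 / 10 * δ`.
  have h := outcome_subset_held_le (T := T) (tie := tie) (b := 1 - δ / 2) (m := n / 4) (l := n / 3)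
      (a := n / 200) hp1.le hq hload hS (D := (sentCopies (st.held \ S) k))
      ?_ ?_ (by linarith) (by linarith) (by rw [← hδ]; linarith) (by exact_mod_cast hSk) ?_ ?_
      (by linarith)
  · refine h.trans (ENNReal.ofReal_le_ofReal ?_)
    rw [mul_comm S.card, pow_mul]
    have hb : 1 / (1 - δ / 2) - 1 ≤ δ := by
      rw [sub_le_iff_le_add, div_le_iff₀ (by linarith)]; nlinarith
    have hb0 : 0 ≤ 1 / (1 - δ / 2) - 1 := by
      rw [sub_nonneg, le_div_iff₀ (by linarith)]; linarith
    have e1 : ((n : ℝ) / 4 + n / 200) / (n - n / 3) = 153 / 400 := by field_simp; norm_num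
    have e2 : (n : ℝ) / 200 / (n - n / 3) = 3 / 400 := by field_simp; norm_num
    rw [e1, e2]
    refine pow_le_pow_left₀ (pow_nonneg (by nlinarith) _) ?_ _
    have h2 : Real.exp (-(3 / 10 * δ * k)) = Real.exp (-(3 / 10 * δ)) ^ k := by
      rw [← Real.exp_nat_mul]; congr 1; ring
    rw [h2]
    refine pow_le_pow_left₀ (by nlinarith) ?_ _
    have h3 := Real.one_sub_le_exp_neg (3 / 10 * δ)
    nlinarith
  · rw [Finset.disjoint_left]
    intro c hc hc'
    rw [mem_sentCopies] at hc hc'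
    exact (Finset.mem_sdiff.1 hc).2 hc'
  · intro c hc hcD hcS
    exact absurd (mem_sentCopies.2 (Finset.mem_sdiff.2 ⟨mem_sentCopies.1 hc, hcS⟩)) hcD
  · intro m _
    refine le_trans ?_ (hdest (T.dest m))
    rw [← Nat.cast_mul, ← card_sentCopies_filter]
    refine Nat.cast_le.2 (Finset.card_le_card (Finset.filter_subset_filter _ fun c hc => ?_))
    rw [mem_sentCopies] at *
    exact (Finset.mem_sdiff.1 hc).1
  · intro m _
    refine le_trans ?_ (hsrc (T.src m))
    rw [← Nat.cast_mul, ← card_sentCopies_filter]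
    refine Nat.cast_le.2 (Finset.card_le_card (Finset.filter_subset_filter _ fun c hc => ?_))
    rcases Finset.mem_union.1 hc with h | h
    · rw [mem_sentCopies] at *
      exact (Finset.mem_sdiff.1 h).1
    · rw [mem_sentCopies] at *
      exact hS h

/-- A phase with low load reduces a class of messages as the number of copies grows. -/
theorem outcome_filter_le_of_low_load {p δ K K' β L : ℝ} (hp1 : p < 1) (hδ : δ = (1 - p) ^ 4)
    {q : ℕ → Fin 4 → Fin n → Fin n → unitInterval} {i k j : ℕ}
    (hq : ∀ s u w, (q i s u w : ℝ) ≤ p)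
    (hsrc : ∀ v, ((st.held.filter fun m => T.src m = v).card : ℝ) * k ≤ n / 3)
    (hdest : ∀ v, ((st.held.filter fun m => T.dest m = v).card : ℝ) * k ≤ n / 4)
    (hk : 1 ≤ k) (hjk : (j : ℝ) * k ≤ n / 200) (hK : 0 < K) (hK' : 0 < K')
    (hKK' : K' ≤ K * Real.exp (k * δ / 5)) (hK'L : K' ≤ L) (hβ : 0 < β)
    (hj : (j : ℝ) < (1 - Real.exp (-(δ / 20))) * (n / (β * L)))
    (P : M → Prop) [DecidablePred P] (hP : ((st.held.filter P).card : ℝ) ≤ n / (β * K)) :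
    (outcome T q i k st).toOuterMeasure {ω | n / (β * K') ≤
      (((nextState T tie st ⟨k, ω.1, ω.2⟩).held.filter P).card : ℝ)} ≤
        ENNReal.ofReal (Real.exp (-(δ / 20)) ^ j) := by
  classical
  have hn0 : (0 : ℝ) < n := by exact_mod_cast Nat.pos_of_ne_zero (NeZero.ne n)
  have hδ0 : 0 < δ :=
    hδ ▸ pow_pos (sub_pos.2 hp1) 4
  -- Survival costs `exp (-(3 / 10 * δ * k))`, while the threshold shrinks at most by `exp (-(k * δ
  -- / 5))`. The surplus `exp (-(δ * k / 10))` is at most `θ * θ`: one factor pays for subtracting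
  -- `j` in the denominator, the other is the base of the tail bound.
  set θ := Real.exp (-(δ / 20)) with hθ
  have hθ0 : 0 < θ := Real.exp_pos _
  have hθ1 : 0 ≤ 1 - θ := sub_nonneg.2 (Real.exp_le_one_iff.2 (by linarith))
  have hL : 0 < L := hK'.trans_le hK'L
  have h1 : (j : ℝ) < (1 - θ) * (n / (β * K')) := hj.trans_le (by gcongr)
  have hσ0 : 0 < n / (β * K') := by positivity
  have hσ : (j : ℝ) < n / (β * K') := by nlinarith
  have htail := toOuterMeasure_card_ge_le (outcome T q i k st)
    (fun ω => (nextState T tie st ⟨k, ω.1, ω.2⟩).held.filter P) (st.held.filter P)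
    (fun ω => Finset.filter_subset_filter _ Finset.sdiff_subset)
    (Real.exp_pos (-(3 / 10 * δ * k))).le hP hσ ?_
  · refine htail.trans (ENNReal.ofReal_le_ofReal (pow_le_pow_left₀ ?_ ?_ _))
    · have : 0 < n / (β * K') - j := by linarith
      positivity
    · rw [div_le_iff₀ (by linarith)]
      have h2 : θ * (θ * (n / (β * K'))) ≤ θ * (n / (β * K') - j) := by
        apply mul_le_mul_of_nonneg_left _ hθ0.le
        linarith
      refine le_trans ?_ h2
      have h3 : n / (β * K) ≤ Real.exp (k * δ / 5) * (n / (β * K')) := by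
        rw [← mul_div_assoc, div_le_div_iff₀ (by positivity) (by positivity)]
        calc (n : ℝ) * (β * K') ≤ n * (β * (K * Real.exp (k * δ / 5))) := by gcongr
          _ = _ := by ring
      calc Real.exp (-(3 / 10 * δ * k)) * (n / (β * K)) ≤
          Real.exp (-(3 / 10 * δ * k)) * (Real.exp (k * δ / 5) * (n / (β * K'))) := by gcongr
        _ = Real.exp (-(δ * k / 10)) * (n / (β * K')) := by
          rw [← mul_assoc, ← Real.exp_add]; congr 2; ring
        _ ≤ (θ * θ) * (n / (β * K')) := by
          rw [hθ, ← Real.exp_add]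
          gcongr
          have : (1 : ℝ) ≤ k := by exact_mod_cast hk
          nlinarith
        _ = _ := by ring
  · intro S hS
    obtain ⟨hSU, hSj⟩ := Finset.mem_powersetCard.1 hS
    have h := outcome_subset_held_le_exp (T := T) (tie := tie) hp1 hδ hq hsrc hdest
      (hSU.trans (Finset.filter_subset _ _)) (by rwa [hSj])
    rw [hSj] at h
    refine le_trans (PMF.toOuterMeasure_mono _ fun ω hω => ?_) h
    exact subset_trans (α := Finset M) hω.1 (Finset.filter_subset _ _)

end Phase

/-! ### The iterated logarithm and the number of copies -/

theorem tower_monotone : Monotone tower :=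
  monotone_nat_of_le_succ fun _ => Nat.lt_two_pow_self.le

theorem le_tower_logStar (n : ℕ) : n ≤ tower (logStar n) :=
  Nat.find_spec (⟨n, le_tower n⟩ : ∃ t, n ≤ tower t)

theorem logStar_le (n : ℕ) : logStar n ≤ n := Nat.find_min' _ (le_tower n)

theorem lt_logStar {t n : ℕ} (h : tower t < n) : t < logStar n := by
  by_contra! hle
  have := (le_tower_logStar n).trans (tower_monotone hle)
  omega

section CopyParam

variable {p : ℝ} {n : ℕ}

theorem copyParam_succ (p : ℝ) (n i : ℕ) : copyParam p n (i + 1) =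
    min (copyParam p n i * Real.exp (numCopies p n i * (1 - p) ^ 4 / 5)) (Real.logb 2 n) := rfl

theorem one_le_logb (hn : 2 ≤ n) : 1 ≤ Real.logb 2 n := by
  rw [Real.le_logb_iff_rpow_le (by norm_num) (by positivity), Real.rpow_one]
  exact_mod_cast hn

theorem copyParam_le_logb (hn : 2 ≤ n) (i : ℕ) : copyParam p n i ≤ Real.logb 2 n := by
  cases i with
  | zero => exact one_le_logb hn
  | succ i => exact min_le_right _ _

theorem one_le_copyParam (hn : 2 ≤ n) (i : ℕ) : 1 ≤ copyParam p n i := by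
  induction i with
  | zero => exact le_rfl
  | succ i ih =>
    rw [copyParam_succ]
    refine le_min ?_ (one_le_logb hn)
    refine one_le_mul_of_one_le_of_one_le ih (Real.one_le_exp ?_)
    have : 0 ≤ (1 - p) ^ 4 := by positivity
    positivity

theorem one_le_numCopies (hn : 2 ≤ n) (i : ℕ) : 1 ≤ numCopies p n i :=
  Nat.le_floor (by simpa using one_le_copyParam hn i)

theorem numCopies_le_copyParam (hn : 2 ≤ n) (i : ℕ) : (numCopies p n i : ℝ) ≤ copyParam p n i :=
  Nat.floor_le (zero_le_one.trans (one_le_copyParam hn i))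

theorem copyParam_monotone (hn : 2 ≤ n) : Monotone (copyParam p n) :=
  monotone_nat_of_le_succ fun i => by
    rw [copyParam_succ]
    refine le_min ?_ (copyParam_le_logb hn i)
    refine le_mul_of_one_le_right (zero_le_one.trans (one_le_copyParam hn i)) (Real.one_le_exp ?_)
    have : 0 ≤ (1 - p) ^ 4 := by positivity
    positivity

/-- While the parameter is below 2, one copy is made and the parameter grows by `exp (δ / 5)`. The
ceiling is the first index at which it reaches 2, and `hL` keeps the cap `Real.logb 2 n` inactive
until then. -/
theorem copyParam_eq_exp {δ : ℝ} (hδ : δ = (1 - p) ^ 4) (hδ0 : 0 < δ) (hn : 2 ≤ n) {t : ℕ}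
    (ht : t ≤ ⌈Real.log 2 / (δ / 5)⌉₊)
    (hL : Real.exp (δ / 5 * (⌈Real.log 2 / (δ / 5)⌉₊ : ℝ)) ≤ Real.logb 2 n) :
    copyParam p n t = Real.exp (δ / 5 * t) := by
  induction t with
  | zero => simp [copyParam]
  | succ t ih =>
    have ih := ih (by omega)
    have hlt : (t : ℝ) < Real.log 2 / (δ / 5) := Nat.lt_ceil.1 (by omega)
    have hlt2 : copyParam p n t < 2 := by
      rw [ih, ← Real.exp_log (by norm_num : (0 : ℝ) < 2), Real.exp_lt_exp]
      rwa [lt_div_iff₀ (by positivity), mul_comm] at hlt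
    have hk : numCopies p n t = 1 := by
      refine le_antisymm ?_ (one_le_numCopies hn t)
      have : numCopies p n t < 2 := (Nat.floor_lt' (by norm_num)).2 (by simpa using hlt2)
      omega
    rw [copyParam_succ, hk, ih, ← hδ, ← Real.exp_add, min_eq_left]
    · congr 1; push_cast; ring
    · refine le_trans (Real.exp_le_exp.2 ?_) hL
      have h1 : ((t + 1 : ℕ) : ℝ) ≤ (⌈Real.log 2 / (δ / 5)⌉₊ : ℝ) := by exact_mod_cast ht
      push_cast at h1 ⊢
      nlinarith

theorem numCopies_eq_one {δ : ℝ} (hδ : δ = (1 - p) ^ 4) (hδ0 : 0 < δ) (hn : 2 ≤ n) {t : ℕ}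
    (ht : t < ⌈Real.log 2 / (δ / 5)⌉₊)
    (hL : Real.exp (δ / 5 * (⌈Real.log 2 / (δ / 5)⌉₊ : ℝ)) ≤ Real.logb 2 n) :
    numCopies p n t = 1 := by
  have hlt : (t : ℝ) < Real.log 2 / (δ / 5) := Nat.lt_ceil.1 ht
  refine le_antisymm ?_ (one_le_numCopies hn t)
  have : numCopies p n t < 2 := by
    refine (Nat.floor_lt' (by norm_num)).2 ?_
    rw [copyParam_eq_exp hδ hδ0 hn ht.le hL, Nat.cast_ofNat,
      ← Real.exp_log (by norm_num : (0 : ℝ) < 2), Real.exp_lt_exp]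
    rwa [lt_div_iff₀ (by positivity), mul_comm] at hlt
  omega

theorem min_exp_le_copyParam {a : ℝ} (ha : a = (1 - p) ^ 4 / 5) (hn : 2 ≤ n) (i : ℕ) :
    min (Real.exp (a * i)) (Real.logb 2 n) ≤ copyParam p n i := by
  have ha0 : 0 ≤ a := by rw [ha]; positivity
  induction i with
  | zero => simp [copyParam]
  | succ i ih =>
    rw [copyParam_succ]
    refine le_min ?_ (min_le_right _ _)
    have h1 : 1 ≤ Real.exp (numCopies p n i * (1 - p) ^ 4 / 5) := by
      refine Real.one_le_exp ?_
      positivity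
    have h2 : Real.exp a ≤ Real.exp (numCopies p n i * (1 - p) ^ 4 / 5) := by
      rw [Real.exp_le_exp, mul_div_assoc, ← ha]
      have : (1 : ℝ) ≤ numCopies p n i := by exact_mod_cast one_le_numCopies hn i
      nlinarith
    have h0 : 0 ≤ copyParam p n i := zero_le_one.trans (one_le_copyParam hn i)
    rcases min_le_iff.1 ih with h | h
    · refine (min_le_left _ _).trans ?_
      have : Real.exp (a * (i + 1 : ℕ)) = Real.exp (a * i) * Real.exp a := by
        rw [← Real.exp_add]; congr 1; push_cast; ring
      rw [this]
      gcongr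
    · exact (min_le_right _ _).trans (h.trans (le_mul_of_one_le_right h0 h1))

theorem min_exp_le_copyParam_succ {a : ℝ} (ha : a = (1 - p) ^ 4 / 5) (hn : 2 ≤ n) (i : ℕ) :
    min (Real.exp (a * (copyParam p n i - 1))) (Real.logb 2 n) ≤ copyParam p n (i + 1) := by
  have ha0 : 0 ≤ a := by rw [ha]; positivity
  rw [copyParam_succ]
  refine min_le_min_right _ ?_
  have h1 : copyParam p n i - 1 ≤ numCopies p n i := by
    have : copyParam p n i < numCopies p n i + 1 := Nat.lt_floor_add_one _
    linarith
  have h2 : Real.exp (a * (copyParam p n i - 1)) ≤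
      Real.exp (numCopies p n i * (1 - p) ^ 4 / 5) := by
    rw [Real.exp_le_exp, mul_div_assoc, ← ha, mul_comm]
    gcongr
  exact h2.trans (le_mul_of_one_le_left (Real.exp_pos _).le (one_le_copyParam hn i))

/-- The right side is a lower bound for the parameter two phases after `K`. One phase may yield a
power with base below two; two exponentials beat `2 ^ K`, and bounding the inner one by its
quadratic term suffices. -/
theorem two_rpow_le_exp_exp {a K : ℝ} (ha : 0 < a) (hK : 2 + 2 * (2 + a) / a ^ 3 ≤ K) :
    (2 : ℝ) ^ K ≤ Real.exp (a * (Real.exp (a * (K - 1)) - 1)) := by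
  have hx : 0 < 2 * (2 + a) / a ^ 3 := by positivity
  set s := K - 1 with hs
  have hs1 : 1 ≤ s := by linarith
  have hs2 : 2 * (2 + a) ≤ a ^ 3 * s := by
    have : 2 * (2 + a) / a ^ 3 ≤ s := by linarith
    rw [div_le_iff₀ (by positivity)] at this
    linarith
  have h1 := Real.quadratic_le_exp_of_nonneg (x := a * s) (by positivity)
  rw [← Real.exp_log (by norm_num : (0 : ℝ) < 2), ← Real.exp_mul, Real.exp_le_exp]
  have hlog : Real.log 2 ≤ 1 := by
    have := Real.log_two_lt_d9
    linarith
  have h2 : Real.log 2 * K ≤ s + 1 := by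
    have : Real.log 2 * K ≤ 1 * K := mul_le_mul_of_nonneg_right hlog (by linarith)
    linarith
  have h3 : (2 + a) * s ≤ a * ((a * s) ^ 2 / 2) := by
    have := mul_le_mul_of_nonneg_right hs2 (zero_le_one.trans hs1)
    linarith [show a * ((a * s) ^ 2 / 2) = a ^ 3 * s * s / 2 by ring]
  have h4 : a * ((a * s) ^ 2 / 2) ≤ a * (Real.exp (a * s) - 1) := by
    have : 0 ≤ a * s := by positivity
    apply mul_le_mul_of_nonneg_left _ ha.le
    linarith
  have h5 : a * 1 ≤ a * s := mul_le_mul_of_nonneg_left hs1 ha.le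
  linarith

/-- After a constant number of phases, the number of copies grows, every second phase, at least
like a tower of twos, until it reaches its maximum. -/
theorem exists_min_tower_le_copyParam (hp : p < 1) : ∃ i₁ : ℕ, ∀ n : ℕ, 2 ≤ n → ∀ t : ℕ,
    min (tower t : ℝ) (Real.logb 2 n) ≤ copyParam p n (i₁ + 2 * t) := by
  set a := (1 - p) ^ 4 / 5 with ha
  have ha0 : 0 < a := by
    have : 0 < 1 - p := by linarith
    positivity
  set X := 2 + 2 * (2 + a) / a ^ 3 with hX
  have hX1 : 1 ≤ X := by
    have : 0 < 2 * (2 + a) / a ^ 3 := by positivity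
    linarith
  obtain ⟨i₁, hi₁⟩ := exists_nat_ge (Real.log X / a)
  refine ⟨i₁, fun n hn => ?_⟩
  -- The threshold `X` above which two phases exponentiate is carried through the induction; early
  -- towers may lie below it.
  suffices H : ∀ t, min (max X (tower t)) (Real.logb 2 n) ≤ copyParam p n (i₁ + 2 * t) from
    fun t => (min_le_min_right _ (le_max_right _ _)).trans (H t)
  intro t
  induction t with
  | zero =>
    refine le_trans (min_le_min_right _ ?_) (min_exp_le_copyParam ha hn _)
    rw [div_le_iff₀ ha0] at hi₁
    rw [mul_zero, add_zero]
    refine max_le ?_ ?_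
    · rw [← Real.log_le_iff_le_exp (by linarith)]; linarith
    · simp only [tower, Nat.cast_one]
      exact Real.one_le_exp (by positivity)
  | succ t ih =>
    have hmono := copyParam_monotone (p := p) hn
    rcases min_le_iff.1 ih with h | h
    · have hK := (le_max_left _ _).trans h
      have ht := (le_max_right _ _).trans h
      set K := copyParam p n (i₁ + 2 * t) with hKdef
      have h1 := min_exp_le_copyParam_succ ha hn (i₁ + 2 * t)
      rw [← hKdef] at h1
      have h2 := min_exp_le_copyParam_succ ha hn (i₁ + 2 * t + 1)
      have e : i₁ + 2 * (t + 1) = i₁ + 2 * t + 1 + 1 := by ring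
      rw [e]
      rcases min_le_iff.1 h1 with h1 | h1
      · refine le_trans (min_le_min_right _ ?_) h2
        have h3 : (2 : ℝ) ^ K ≤ Real.exp (a * (copyParam p n (i₁ + 2 * t + 1) - 1)) := by
          refine (two_rpow_le_exp_exp ha0 hK).trans ?_
          gcongr
        refine le_trans ?_ h3
        refine max_le ?_ ?_
        · have : K ≤ (2 : ℝ) ^ K := by
            have hh := one_add_mul_self_le_rpow_one_add (s := 1) (by norm_num) (p := K)
              (by linarith)
            norm_num at hh
            linarith
          linarith
        · have : ((tower (t + 1) : ℕ) : ℝ) = (2 : ℝ) ^ (tower t : ℝ) := by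
            rw [Real.rpow_natCast]; simp [tower]
          rw [this]
          exact Real.rpow_le_rpow_of_exponent_le (by norm_num) ht
      · exact (min_le_right _ _).trans (h1.trans (hmono (Nat.le_succ _)))
    · exact (min_le_right _ _).trans (h.trans (hmono (by omega)))

theorem exists_copyParam_eq_logb (hp : p < 1) : ∃ i₁ : ℕ, ∀ n : ℕ, 2 ≤ n → ∀ i,
    i₁ + 2 * logStar n ≤ i → copyParam p n i = Real.logb 2 n := by
  obtain ⟨i₁, h⟩ := exists_min_tower_le_copyParam hp
  refine ⟨i₁, fun n hn i hi => le_antisymm (copyParam_le_logb hn i) ?_⟩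
  refine le_trans ?_ ((h n hn (logStar n)).trans (copyParam_monotone hn hi))
  refine le_min ?_ le_rfl
  have h1 : (n : ℝ) ≤ tower (logStar n) := by exact_mod_cast le_tower_logStar n
  refine le_trans ?_ h1
  rw [Real.logb_le_iff_le_rpow (by norm_num) (by positivity), Real.rpow_natCast]
  exact_mod_cast Nat.lt_two_pow_self.le

end CopyParam

/-! ### The load in the phases with a single copy of each message -/

/-- A bound on the fraction of messages destined to a node that are still held after `t` phases with
a single copy of each message. -/
noncomputable def destLoad (δ ε : ℝ) : ℕ → ℝ
  | 0 => 1
  | t + 1 => min 1 (destLoad δ ε t * (1 - 5 / 8 * δ) + ε)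

/-- A bound on the fraction of its messages that a node still holds after `t` phases with a single
copy of each message. -/
noncomputable def srcLoad (δ ε : ℝ) : ℕ → ℝ
  | 0 => 1
  | t + 1 => min 1 (srcLoad δ ε t * (1 - δ * (1 - destLoad δ ε t)) + ε)

theorem destLoad_le_one (δ ε : ℝ) (t : ℕ) : destLoad δ ε t ≤ 1 := by
  cases t with
  | zero => exact le_rfl
  | succ t => exact min_le_left _ _

theorem srcLoad_le_one (δ ε : ℝ) (t : ℕ) : srcLoad δ ε t ≤ 1 := by
  cases t with
  | zero => exact le_rfl
  | succ t => exact min_le_left _ _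

section

variable {δ ε : ℝ}

theorem destLoad_nonneg (hδ1 : δ ≤ 1) (hε : 0 ≤ ε) (t : ℕ) : 0 ≤ destLoad δ ε t := by
  induction t with
  | zero => exact zero_le_one
  | succ t ih => exact le_min zero_le_one (add_nonneg (mul_nonneg ih (by linarith)) hε)

theorem srcLoad_nonneg (hδ0 : 0 ≤ δ) (hδ1 : δ ≤ 1) (hε : 0 ≤ ε) (t : ℕ) : 0 ≤ srcLoad δ ε t := by
  induction t with
  | zero => exact zero_le_one
  | succ t ih =>
    refine le_min zero_le_one (add_nonneg (mul_nonneg ih ?_) hε)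
    have := destLoad_nonneg hδ1 hε t
    nlinarith

theorem continuous_destLoad (δ : ℝ) (t : ℕ) : Continuous fun ε => destLoad δ ε t := by
  induction t with
  | zero => exact continuous_const
  | succ t ih =>
    simp only [destLoad]
    fun_prop

theorem continuous_srcLoad (δ : ℝ) (t : ℕ) : Continuous fun ε => srcLoad δ ε t := by
  induction t with
  | zero => exact continuous_const
  | succ t ih =>
    have := continuous_destLoad δ t
    simp only [srcLoad]
    fun_prop

theorem destLoad_zero_le (hδ1 : δ ≤ 1) (t : ℕ) : destLoad δ 0 t ≤ Real.exp (-(5 / 8 * δ * t)) := by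
  induction t with
  | zero => simp [destLoad]
  | succ t ih =>
    refine (min_le_right _ _).trans ?_
    have h1 := Real.one_sub_le_exp_neg (5 / 8 * δ)
    have e : Real.exp (-(5 / 8 * δ * (t + 1 : ℕ))) =
        Real.exp (-(5 / 8 * δ * t)) * Real.exp (-(5 / 8 * δ)) := by
      rw [← Real.exp_add]; congr 1; push_cast; ring
    rw [add_zero, e]
    exact mul_le_mul ih h1 (by linarith) (Real.exp_pos _).le

/-- Collisions cost the sender an exponent of `δ` times the sum of the destination loads. Each
summand, times `δ`, is at most `8 / 5` of the decrease of the destination load in that phase, so the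
sum telescopes. -/
theorem srcLoad_zero_le (hδ0 : 0 ≤ δ) (hδ1 : δ ≤ 1) (t : ℕ) :
    srcLoad δ 0 t ≤ Real.exp (-(δ * t) + 8 / 5 * (1 - destLoad δ 0 t)) := by
  induction t with
  | zero => simp [srcLoad, destLoad]
  | succ t ih =>
    refine (min_le_right _ _).trans ?_
    have hY0 := destLoad_nonneg hδ1 le_rfl t
    have hY : destLoad δ 0 (t + 1) ≤ destLoad δ 0 t * (1 - 5 / 8 * δ) + 0 := min_le_right _ _
    have h1 := Real.one_sub_le_exp_neg (δ * (1 - destLoad δ 0 t))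
    have h2 : 0 ≤ 1 - δ * (1 - destLoad δ 0 t) := by nlinarith
    rw [add_zero]
    refine (mul_le_mul ih h1 h2 (Real.exp_pos _).le).trans ?_
    rw [← Real.exp_add, Real.exp_le_exp]
    push_cast
    nlinarith

/-- If the error term `ε` is small, the load is low at the end of the phases with a single copy of
each message. -/
theorem exists_load_lt (hδ0 : 0 < δ) (hδ1 : δ ≤ 1) : ∃ ε : ℝ, 0 < ε ∧
    Real.exp (δ / 5 * (⌈Real.log 2 / (δ / 5)⌉₊ : ℝ)) *
      srcLoad δ ε ⌈Real.log 2 / (δ / 5)⌉₊ < 1 / 3 ∧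
    Real.exp (δ / 5 * (⌈Real.log 2 / (δ / 5)⌉₊ : ℝ)) *
      destLoad δ ε ⌈Real.log 2 / (δ / 5)⌉₊ < 1 / 4 := by
  set t := ⌈Real.log 2 / (δ / 5)⌉₊ with ht
  have hlog2 := Real.log_two_gt_d9
  have ht1 : 5 * Real.log 2 ≤ δ * t := by
    have := Nat.le_ceil (Real.log 2 / (δ / 5))
    rw [← ht, div_le_iff₀ (by positivity)] at this
    linarith
  have hexp2 : ∀ m : ℕ, Real.exp (-(m * Real.log 2)) = 1 / 2 ^ m := fun m => by
    rw [Real.exp_neg, Real.exp_nat_mul, Real.exp_log (by norm_num), one_div]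
  have hsrc : Real.exp (δ / 5 * t) * srcLoad δ 0 t < 1 / 3 := by
    have h0 := destLoad_nonneg hδ1 le_rfl t
    calc Real.exp (δ / 5 * t) * srcLoad δ 0 t
        ≤ Real.exp (δ / 5 * t) * Real.exp (-(δ * t) + 8 / 5 * (1 - destLoad δ 0 t)) := by
          gcongr
          exact srcLoad_zero_le hδ0.le hδ1 t
      -- The choice of `t` gives `δ * t ≥ 5 * log 2`, so the exponent `-(4 / 5) * δ * t` is worth at
      -- least four halvings. What remains is `exp (8 / 5) < 16 / 3`.
      _ ≤ Real.exp (8 / 5) * Real.exp (-((4 : ℕ) * Real.log 2)) := by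
          rw [← Real.exp_add, ← Real.exp_add, Real.exp_le_exp]
          push_cast
          linarith
      _ < 16 / 3 * Real.exp (-((4 : ℕ) * Real.log 2)) := by
          gcongr
          refine lt_of_pow_lt_pow_left₀ 5 (by norm_num) ?_
          rw [← Real.exp_nat_mul]
          have e : ((5 : ℕ) : ℝ) * (8 / 5) = (8 : ℕ) * 1 := by norm_num
          rw [e, Real.exp_nat_mul]
          have h1 := Real.exp_one_lt_d9
          calc Real.exp 1 ^ 8 ≤ (2.7182818286 : ℝ) ^ 8 := by gcongr
            _ < _ := by norm_num
      _ = 1 / 3 := by rw [hexp2]; norm_num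
  have hdest : Real.exp (δ / 5 * t) * destLoad δ 0 t < 1 / 4 := by
    calc Real.exp (δ / 5 * t) * destLoad δ 0 t
        ≤ Real.exp (δ / 5 * t) * Real.exp (-(5 / 8 * δ * t)) := by
          gcongr
          exact destLoad_zero_le hδ1 t
      _ < Real.exp (-((2 : ℕ) * Real.log 2)) := by
          rw [← Real.exp_add, Real.exp_lt_exp]
          push_cast
          linarith
      _ = 1 / 4 := by rw [hexp2]; norm_num
  -- The strict inequalities at `ε = 0` persist for small positive `ε`, because `t` is fixed and the
  -- recursions are continuous in `ε`.
  have h1 : Continuous fun ε => Real.exp (δ / 5 * t) * srcLoad δ ε t :=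
    continuous_const.mul (continuous_srcLoad δ t)
  have h2 : Continuous fun ε => Real.exp (δ / 5 * t) * destLoad δ ε t :=
    continuous_const.mul (continuous_destLoad δ t)
  have h3 := (h1.continuousAt (x := 0)).eventually_lt continuousAt_const hsrc
  have h4 := (h2.continuousAt (x := 0)).eventually_lt continuousAt_const hdest
  obtain ⟨ε, ⟨h5, h6⟩, hε⟩ := (((h3.and h4).filter_mono nhdsWithin_le_nhds).and
    (self_mem_nhdsWithin (s := Set.Ioi (0 : ℝ)))).exists
  exact ⟨ε, hε, h5, h6⟩

end

/-! ### Large numbers of nodes -/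

theorem eventually_mul_logb_le_sqrt (C : ℝ) :
    ∀ᶠ n : ℕ in Filter.atTop, C * Real.logb 2 n ≤ Real.sqrt n := by
  have h := (isLittleO_log_rpow_atTop (r := 1 / 2) (by norm_num)).bound
    (c := Real.log 2 / (|C| + 1)) (by have := Real.log_pos (one_lt_two (α := ℝ)); positivity)
  filter_upwards [tendsto_natCast_atTop_atTop.eventually h, Filter.eventually_ge_atTop 1]
    with n hn hn1
  have hlog : 0 ≤ Real.log n := Real.log_natCast_nonneg n
  rw [← Real.sqrt_eq_rpow, Real.norm_of_nonneg hlog, Real.norm_of_nonneg (Real.sqrt_nonneg _)] at hn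
  have h2 := Real.log_pos (one_lt_two (α := ℝ))
  rw [Real.logb]
  calc C * (Real.log n / Real.log 2) ≤ (|C| + 1) * (Real.log n / Real.log 2) := by
        gcongr
        linarith [le_abs_self C]
    _ ≤ (|C| + 1) * (Real.log 2 / (|C| + 1) * Real.sqrt n / Real.log 2) := by gcongr
    _ = Real.sqrt n := by field_simp

theorem natSqrt_le_sqrt (n : ℕ) : (n.sqrt : ℝ) ≤ Real.sqrt n := Real.nat_sqrt_le_real_sqrt

/-- The conditions on the number of nodes that are used in the analysis of a phase. -/
structure Large (δ ε τ : ℝ) (n : ℕ) : Prop where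
  two_le : 2 ≤ n
  exp_le : Real.exp (δ / 5 * (⌈Real.log 2 / (δ / 5)⌉₊ : ℝ)) ≤ Real.logb 2 n
  sqrt_lt : n.sqrt < n
  ratio_le : (2 + 1 / τ) * (n.sqrt / (n - n.sqrt)) ≤ ε / 8
  sqrt_le : (n.sqrt : ℝ) ≤ ε / 2 * n
  sqrt_mul_le : (n.sqrt : ℝ) * Real.logb 2 n ≤ n / 200
  sqrt_lt_div : (n.sqrt : ℝ) < (1 - Real.exp (-(δ / 20))) * (n / (4 * Real.logb 2 n))

theorem eventually_large {δ ε τ : ℝ} (hδ : 0 < δ) (hε : 0 < ε) (hτ : 0 < τ) :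
    ∀ᶠ n : ℕ in Filter.atTop, Large δ ε τ n := by
  have hθ : 0 < 1 - Real.exp (-(δ / 20)) := sub_pos.2 (Real.exp_lt_one_iff.2 (by linarith))
  filter_upwards [Filter.eventually_ge_atTop 2,
    (Real.tendsto_logb_atTop one_lt_two).comp tendsto_natCast_atTop_atTop |>.eventually_ge_atTop
      (Real.exp (δ / 5 * (⌈Real.log 2 / (δ / 5)⌉₊ : ℝ))),
    eventually_mul_logb_le_sqrt (1 + (2 + 1 / τ) / (ε / 8)), eventually_mul_logb_le_sqrt (2 / ε),
    eventually_mul_logb_le_sqrt 200,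
    eventually_mul_logb_le_sqrt (5 / (1 - Real.exp (-(δ / 20))))] with n h2 hexp h3 h4 h5 h6
  have hL := one_le_logb h2
  have hj := natSqrt_le_sqrt n
  set s := Real.sqrt n with hs
  have hsn : s * s = n := Real.mul_self_sqrt (Nat.cast_nonneg n)
  have hs0 : 0 < s := Real.sqrt_pos.2 (by positivity)
  have h3' : 1 + (2 + 1 / τ) / (ε / 8) ≤ s := by
    refine le_trans (le_mul_of_one_le_right (by positivity) hL) h3
  have hs1 : 1 < s := by
    have : 0 < (2 + 1 / τ) / (ε / 8) := by positivity
    linarith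
  have hnj : s * (s - 1) ≤ n - n.sqrt := by nlinarith
  refine ⟨h2, hexp, Nat.sqrt_lt_self (by omega), ?_, ?_, ?_, ?_⟩
  · have h7 : (n.sqrt : ℝ) / (n - n.sqrt) ≤ 1 / (s - 1) := by
      have h8 : 0 < s * (s - 1) := mul_pos hs0 (by linarith)
      calc (n.sqrt : ℝ) / (n - n.sqrt) ≤ s / (s * (s - 1)) := by gcongr
        _ = 1 / (s - 1) := by
          have : s - 1 ≠ 0 := by linarith
          field_simp
    calc (2 + 1 / τ) * (n.sqrt / (n - n.sqrt)) ≤ (2 + 1 / τ) * (1 / (s - 1)) := by gcongr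
      _ ≤ ε / 8 := by
        rw [mul_one_div, div_le_iff₀ (by linarith), mul_comm, ← div_le_iff₀ (by positivity)]
        linarith
  · have h7 : 2 / ε ≤ s := le_trans (le_mul_of_one_le_right (by positivity) hL) h4
    rw [div_le_iff₀ hε] at h7
    rw [← hsn]
    nlinarith
  · calc (n.sqrt : ℝ) * Real.logb 2 n ≤ s * (s / 200) := by
          gcongr
          linarith
      _ = n / 200 := by rw [← hsn]; ring
  · refine hj.trans_lt ?_
    rw [← mul_div_assoc, lt_div_iff₀ (by linarith)]
    rw [div_mul_eq_mul_div, div_le_iff₀ hθ] at h6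
    have h7 : 0 < s * Real.logb 2 n := mul_pos hs0 (by linarith)
    have h8 := mul_le_mul_of_nonneg_left h6 hs0.le
    have h9 : (1 - Real.exp (-(δ / 20))) * (n : ℝ) =
        s * (s * (1 - Real.exp (-(δ / 20)))) := by rw [← hsn]; ring
    linarith

section Run

variable {n : ℕ} [NeZero n] {M : Type*} [Fintype M] [DecidableEq M] {T : Task n M}
  {tie : TieRule n M} {q : ℕ → Fin 4 → Fin n → Fin n → unitInterval} {p δ ε τ e : ℝ}

/-! ### The state after a number of phases -/

theorem run_succ (p : ℝ) (T : Task n M) (tie : TieRule n M)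
    (q : ℕ → Fin 4 → Fin n → Fin n → unitInterval) (i : ℕ) :
    run p T tie q (i + 1) = (run p T tie q i).bind (phase T tie q i (numCopies p n i)) := rfl

theorem good_init (hT : T.IsSymmetric) : Good T n n 0 (State.init n M) where
  src_le v := by simp [State.init, (hT v).1]
  dest_le v := by simp [State.init, (hT v).2]
  rounds_le := by simp [State.init]
  delivered m hm := absurd (Finset.mem_univ m) hm

/-- Failure probabilities of an invariant add up from phase to phase. -/
theorem run_succ_toOuterMeasure_le {i : ℕ} {A B : Set (State n M)} {c d : ℝ} (hc : 0 ≤ c)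
    (hd : 0 ≤ d) (hA : (run p T tie q i).toOuterMeasure Aᶜ ≤ ENNReal.ofReal c)
    (hB : ∀ st ∈ A, (phase T tie q i (numCopies p n i) st).toOuterMeasure B ≤ ENNReal.ofReal d) :
    (run p T tie q (i + 1)).toOuterMeasure B ≤ ENNReal.ofReal (c + d) := by
  rw [run_succ]
  refine (toOuterMeasure_bind_le _ _ A Set.univ B (fun st hst _ => hB st hst)
    fun st _ h => absurd (Set.mem_univ st) h).trans ?_
  rw [ENNReal.ofReal_add hc hd]
  have h1 : (run p T tie q i).toOuterMeasure Set.univ = 1 := by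
    rw [PMF.toOuterMeasure_apply_eq_one_iff]
    exact Set.subset_univ _
  rw [h1, mul_one]
  gcongr

theorem run_not_good_le_of_single (hp1 : p < 1) (hδ : δ = (1 - p) ^ 4)
    (hq : ∀ i s u w, (q i s u w : ℝ) ≤ p) (hT : T.IsSymmetric) (hε : 0 < ε)
    (hτ : τ = min δ (ε / 8)) (hn : Large δ ε τ n)
    (he : ((1 + ε / 4) / (1 + ε / 2)) ^ n.sqrt ≤ e) {i : ℕ}
    (hi : i ≤ ⌈Real.log 2 / (δ / 5)⌉₊) :
    (run p T tie q i).toOuterMeasure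
        {st | Good T (srcLoad δ ε i * n) (destLoad δ ε i * n) i st}ᶜ ≤
      ENNReal.ofReal (i * (2 * n * e)) := by
  have hp0 : 0 ≤ p := (q 0 0 0 0).2.1.trans (hq 0 0 0 0)
  have hδ0 : 0 < δ :=
    hδ ▸ pow_pos (sub_pos.2 hp1) 4
  have hδ1 : δ ≤ 1 := by rw [hδ]; exact pow_le_one₀ (by linarith) (by linarith)
  have he0 : 0 ≤ e := le_trans (by positivity) he
  induction i with
  | zero =>
    have h := good_init hT
    simp only [run, PMF.toOuterMeasure_pure_apply, srcLoad, destLoad, one_mul]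
    simp [h]
  | succ i ih =>
    have ih := ih (by omega)
    have e1 : ((i + 1 : ℕ) : ℝ) * (2 * n * e) = i * (2 * n * e) + 2 * n * e := by
      push_cast; ring
    rw [e1]
    refine run_succ_toOuterMeasure_le (by positivity) (by positivity) ih fun st hst => ?_
    rw [numCopies_eq_one hδ hδ0 hn.two_le (by omega) hn.exp_le]
    have hst : Good T (srcLoad δ ε i * n) (destLoad δ ε i * n) i st := hst
    have hu := srcLoad_le_one δ ε i
    have hy := destLoad_le_one δ ε i
    have hun : srcLoad δ ε i * n ≤ n := mul_le_of_le_one_left (Nat.cast_nonneg n) hu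
    have hyn : destLoad δ ε i * n ≤ n := mul_le_of_le_one_left (Nat.cast_nonneg n) hy
    -- Where the load bound is capped at 1 it cannot be exceeded, as counts never grow; otherwise
    -- the tail bound for the uncapped value applies.
    have hmin : ∀ z x : ℝ, x ≤ n → min 1 z * n < x → z * n ≤ x := by
      intro z x hx h
      rcases min_choice 1 z with h1 | h1
      · rw [h1, one_mul] at h
        exact absurd hx (not_le.2 h)
      · rw [h1] at h
        exact h.le
    have hheld : ∀ (y : (Copy M 1 → Fin n) × (Fin 4 × Copy M 1 → Bool)) (P : M → Prop)
        [DecidablePred P], (((nextState T tie st ⟨1, y.1, y.2⟩).held.filter P).card : ℝ) ≤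
          (st.held.filter P).card := fun y P _ =>
      Nat.cast_le.2 (Finset.card_le_card (Finset.filter_subset_filter _ Finset.sdiff_subset))
    have hτ0 : 0 < τ := by rw [hτ]; exact lt_min hδ0 (by linarith)
    refine phase_not_good_le hst (fun v => ?_) (fun v => ?_) fun v => ?_
    · rw [mul_one]; exact_mod_cast (hst.src_le v).trans hun
    · refine le_trans (PMF.toOuterMeasure_mono _ ?_) ((outcome_src_le_of_single (tie := tie) hp1 hδ
        (hq i) hst (srcLoad_nonneg hδ0.le hδ1 hε.le i) hu (destLoad_nonneg hδ1 hε.le i) hy hε hτ0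
        (hτ ▸ min_le_left _ _) (hτ ▸ min_le_right _ _) hn.sqrt_lt hn.ratio_le hn.sqrt_le le_rfl
        v).trans (ENNReal.ofReal_le_ofReal he))
      rintro ω ⟨hω, -⟩
      exact hmin _ _ ((hheld ω _).trans ((hst.src_le v).trans hun)) hω
    · refine le_trans (PMF.toOuterMeasure_mono _ ?_) ((outcome_dest_le_of_single (tie := tie) hp1 hδ
        (hq i) hst hu hy hε hn.sqrt_le le_rfl v).trans (ENNReal.ofReal_le_ofReal he))
      rintro ω ⟨hω, -⟩
      exact hmin _ _ ((hheld ω _).trans ((hst.dest_le v).trans hyn)) hω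

theorem mul_numCopies_le (hn : 2 ≤ n) {β x : ℝ} {i : ℕ} (hβ : 0 < β)
    (hx : x ≤ n / (β * copyParam p n i)) : x * numCopies p n i ≤ n / β := by
  have hK := one_le_copyParam (p := p) hn i
  have hk := numCopies_le_copyParam (p := p) hn i
  calc x * numCopies p n i ≤ n / (β * copyParam p n i) * numCopies p n i := by gcongr
    _ ≤ n / (β * copyParam p n i) * copyParam p n i := by gcongr
    _ = n / β := by
      have : copyParam p n i ≠ 0 := by linarith
      field_simp

theorem phase_not_good_le_of_low_load (hp1 : p < 1) (hδ : δ = (1 - p) ^ 4)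
    (hq : ∀ i s u w, (q i s u w : ℝ) ≤ p) (hn : Large δ ε τ n)
    (he : Real.exp (-(δ / 20)) ^ n.sqrt ≤ e) {i : ℕ} {st : State n M}
    (hst : Good T (n / (3 * copyParam p n i)) (n / (4 * copyParam p n i)) i st) :
    (phase T tie q i (numCopies p n i) st).toOuterMeasure
        {st | Good T (n / (3 * copyParam p n (i + 1))) (n / (4 * copyParam p n (i + 1))) (i + 1)
          st}ᶜ ≤
      ENNReal.ofReal (2 * n * e) := by
  have h2 := hn.two_le
  have hδ0 : 0 < δ :=
    hδ ▸ pow_pos (sub_pos.2 hp1) 4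
  have hθ : 0 ≤ 1 - Real.exp (-(δ / 20)) := sub_nonneg.2 (Real.exp_le_one_iff.2 (by linarith))
  have hK := one_le_copyParam (p := p) h2 i
  have hK' := one_le_copyParam (p := p) h2 (i + 1)
  have hL := one_le_logb h2
  have hsrc := fun v => mul_numCopies_le h2 (by norm_num) (hst.src_le v)
  have hdest := fun v => mul_numCopies_le h2 (by norm_num) (hst.dest_le v)
  have hjk : (n.sqrt : ℝ) * numCopies p n i ≤ n / 200 := by
    refine le_trans ?_ hn.sqrt_mul_le
    gcongr
    exact (numCopies_le_copyParam h2 i).trans (copyParam_le_logb h2 i)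
  have hKK' : copyParam p n (i + 1) ≤ copyParam p n i * Real.exp (numCopies p n i * δ / 5) := by
    rw [hδ]; exact min_le_left _ _
  have hj3 : (n.sqrt : ℝ) < (1 - Real.exp (-(δ / 20))) * (n / (3 * Real.logb 2 n)) := by
    refine hn.sqrt_lt_div.trans_le ?_
    gcongr
    norm_num
  refine phase_not_good_le hst (fun v => ?_) (fun v => ?_) fun v => ?_
  · have h := (hsrc v).trans (div_le_self (Nat.cast_nonneg n) (by norm_num))
    exact_mod_cast h
  · refine le_trans (MeasureTheory.measure_mono fun ω hω => ?_)
      ((outcome_filter_le_of_low_load (tie := tie) hp1 hδ (hq i) hsrc hdest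
        (one_le_numCopies h2 i) hjk (by linarith) (by linarith) hKK' (copyParam_le_logb h2 _)
        (by norm_num : (0 : ℝ) < 3) hj3 _ (hst.src_le v)).trans (ENNReal.ofReal_le_ofReal he))
    exact le_of_lt (α := ℝ) hω
  · refine le_trans (MeasureTheory.measure_mono fun ω hω => ?_)
      ((outcome_filter_le_of_low_load (tie := tie) hp1 hδ (hq i) hsrc hdest
        (one_le_numCopies h2 i) hjk (by linarith) (by linarith) hKK' (copyParam_le_logb h2 _)
        (by norm_num : (0 : ℝ) < 4) hn.sqrt_lt_div _ (hst.dest_le v)).trans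
          (ENNReal.ofReal_le_ofReal he))
    exact le_of_lt (α := ℝ) hω

/-- The low-load invariant starts where the single-copy phases end: there the parameter is `exp (δ /
5 * t)`, and `hsrc` and `hdest` say that its products with the loads are below `1 / 3` and `1 / 4`.
-/
theorem run_not_good_le (hp1 : p < 1) (hδ : δ = (1 - p) ^ 4)
    (hq : ∀ i s u w, (q i s u w : ℝ) ≤ p) (hT : T.IsSymmetric) (hε : 0 < ε)
    (hsrc : Real.exp (δ / 5 * (⌈Real.log 2 / (δ / 5)⌉₊ : ℝ)) *
      srcLoad δ ε ⌈Real.log 2 / (δ / 5)⌉₊ < 1 / 3)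
    (hdest : Real.exp (δ / 5 * (⌈Real.log 2 / (δ / 5)⌉₊ : ℝ)) *
      destLoad δ ε ⌈Real.log 2 / (δ / 5)⌉₊ < 1 / 4)
    (hτ : τ = min δ (ε / 8)) (hn : Large δ ε τ n)
    (he1 : ((1 + ε / 4) / (1 + ε / 2)) ^ n.sqrt ≤ e) (he2 : Real.exp (-(δ / 20)) ^ n.sqrt ≤ e)
    {i : ℕ} (hi : ⌈Real.log 2 / (δ / 5)⌉₊ ≤ i) :
    (run p T tie q i).toOuterMeasure
        {st | Good T (n / (3 * copyParam p n i)) (n / (4 * copyParam p n i)) i st}ᶜ ≤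
      ENNReal.ofReal (i * (2 * n * e)) := by
  have hδ0 : 0 < δ :=
    hδ ▸ pow_pos (sub_pos.2 hp1) 4
  have he0 : 0 ≤ e := le_trans (by positivity) he2
  induction i, hi using Nat.le_induction with
  | base =>
    refine le_trans (MeasureTheory.measure_mono (Set.compl_subset_compl.2 fun st hst => ?_))
      (run_not_good_le_of_single (tie := tie) hp1 hδ hq hT hε hτ hn he1 le_rfl)
    have hst : Good T _ _ _ st := hst
    rw [Set.mem_ofPred_eq, copyParam_eq_exp hδ hδ0 hn.two_le le_rfl hn.exp_le]
    set K := Real.exp (δ / 5 * (⌈Real.log 2 / (δ / 5)⌉₊ : ℝ)) with hK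
    have hK0 : 0 < K := Real.exp_pos _
    have hn0 : (0 : ℝ) ≤ n := Nat.cast_nonneg n
    refine ⟨fun v => (hst.src_le v).trans ?_, fun v => (hst.dest_le v).trans ?_, hst.rounds_le,
      hst.delivered⟩
    · rw [le_div_iff₀ (by positivity)]
      nlinarith
    · rw [le_div_iff₀ (by positivity)]
      nlinarith
  | succ i hi ih =>
    have e1 : ((i + 1 : ℕ) : ℝ) * (2 * n * e) = i * (2 * n * e) + 2 * n * e := by
      push_cast; ring
    rw [e1]
    exact run_succ_toOuterMeasure_le (by positivity) (by positivity) ih fun st hst =>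
      phase_not_good_le_of_low_load hp1 hδ hq hn he2 hst

/-- Every phase with the maximum number of copies delivers each message that is still held with high
probability. -/
theorem phase_mem_held_le (hp1 : p < 1) (hδ : δ = (1 - p) ^ 4)
    (hq : ∀ i s u w, (q i s u w : ℝ) ≤ p) (hn : Large δ ε τ n) {i : ℕ}
    {st : State n M}
    (hst : Good T (n / (3 * copyParam p n i)) (n / (4 * copyParam p n i)) i st)
    (m : M) (hm : m ∈ st.held) :
    (phase T tie q i (numCopies p n i) st).toOuterMeasure {st | m ∈ st.held} ≤
      ENNReal.ofReal (Real.exp (-(3 / 10 * δ * numCopies p n i))) := by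
  have h2 := hn.two_le
  have hsrc := fun v => mul_numCopies_le h2 (by norm_num) (hst.src_le v)
  have hdest := fun v => mul_numCopies_le h2 (by norm_num) (hst.dest_le v)
  have hsqrt : (1 : ℝ) ≤ n.sqrt := by
    exact_mod_cast Nat.sqrt_pos.2 (by omega : 0 < n)
  have h := outcome_subset_held_le_exp (tie := tie) hp1 hδ (hq i) hsrc hdest
    (Finset.singleton_subset_iff.2 hm) (by
      rw [Finset.card_singleton, Nat.cast_one, one_mul]
      refine le_trans ?_ hn.sqrt_mul_le
      refine ((numCopies_le_copyParam h2 i).trans (copyParam_le_logb h2 i)).trans ?_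
      exact le_mul_of_one_le_left (zero_le_one.trans (one_le_logb h2)) hsqrt)
  rw [Finset.card_singleton, pow_one] at h
  rw [phase_toOuterMeasure]
  refine le_trans (MeasureTheory.measure_mono fun ω hω => ?_) h
  exact Finset.singleton_subset_iff.2 hω

theorem phase_mem_held_eq_zero {i k : ℕ} {st : State n M} (m : M) (hm : m ∉ st.held) :
    (phase T tie q i k st).toOuterMeasure {st | m ∈ st.held} = 0 := by
  rw [phase_toOuterMeasure]
  have : {ω : (Copy M k → Fin n) × (Fin 4 × Copy M k → Bool) |
      nextState T tie st ⟨k, ω.1, ω.2⟩ ∈ {st : State n M | m ∈ st.held}} = ∅ := by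
    ext ω
    simp [held_nextState, hm]
  rw [this]
  exact MeasureTheory.measure_empty

/-- A message held after a phase was held before it, so the probability `P` of being held obeys `P
(R + 1) ≤ B + η * P R`. This makes the survival factors multiply while the bad events only add. -/
theorem run_mem_held_le {η B : ℝ} {i₀ R : ℕ} (hη0 : 0 ≤ η) (hη1 : η ≤ 1) (hB : 0 ≤ B)
    (A : ℕ → Set (State n M)) (m : M)
    (hA : ∀ i, i₀ ≤ i → i < i₀ + R → (run p T tie q i).toOuterMeasure (A i)ᶜ ≤ ENNReal.ofReal B)
    (hm : ∀ i, i₀ ≤ i → i < i₀ + R → ∀ st ∈ A i, m ∈ st.held →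
      (phase T tie q i (numCopies p n i) st).toOuterMeasure {st | m ∈ st.held} ≤
        ENNReal.ofReal η) :
    (run p T tie q (i₀ + R)).toOuterMeasure {st | m ∈ st.held} ≤
      ENNReal.ofReal (η ^ R + R * B) := by
  induction R with
  | zero =>
    rw [pow_zero, Nat.cast_zero, zero_mul, add_zero, add_zero, ENNReal.ofReal_one]
    refine (MeasureTheory.measure_mono (Set.subset_univ _)).trans_eq ?_
    rw [PMF.toOuterMeasure_apply_eq_one_iff]
    exact Set.subset_univ _
  | succ R ih =>
    have ih := ih (fun i hi hi' => hA i hi (by omega)) fun i hi hi' => hm i hi (by omega)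
    rw [← add_assoc, run_succ]
    refine (toOuterMeasure_bind_le _ _ (A (i₀ + R)) {st | m ∈ st.held} _
      (fun st hst hmem => hm _ (by omega) (by omega) st hst hmem)
      fun st _ hmem => phase_mem_held_eq_zero m hmem).trans ?_
    calc _ ≤ ENNReal.ofReal B + ENNReal.ofReal η * ENNReal.ofReal (η ^ R + R * B) := by
          gcongr
          exact hA _ (by omega) (by omega)
      _ = ENNReal.ofReal (B + η * (η ^ R + R * B)) := by
          rw [← ENNReal.ofReal_mul hη0, ← ENNReal.ofReal_add hB (by positivity)]
      _ ≤ _ := by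
          refine ENNReal.ofReal_le_ofReal ?_
          have : η * (R * B) ≤ 1 * (R * B) := mul_le_mul_of_nonneg_right hη1 (by positivity)
          rw [pow_succ']
          push_cast
          linarith

end Run

/-! ### The final estimates -/

theorem log_le_logb (n : ℕ) : Real.log n ≤ Real.logb 2 n := by
  rw [Real.logb, le_div_iff₀ (Real.log_pos one_lt_two)]
  have h := Real.log_two_lt_d9
  exact mul_le_of_le_one_right (Real.log_natCast_nonneg n) (by linarith)

theorem eventually_pow_mul_exp_sqrt_le {c r K : ℝ} (hc : 0 < c) (hr : 0 < r) (hK : 1 ≤ K) :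
    ∀ᶠ n : ℕ in Filter.atTop,
      4 * K * (n : ℝ) ^ 5 * Real.exp (-(r * n.sqrt)) ≤ 1 / 2 * (1 / (n : ℝ) ^ c) := by
  have hlogK : 0 ≤ Real.log (8 * K) := Real.log_nonneg (by linarith)
  filter_upwards [Filter.eventually_ge_atTop 2,
    eventually_mul_logb_le_sqrt ((5 + c + Real.log (8 * K) + r) / r)] with n h2 h
  have hn0 : (0 : ℝ) < n := by positivity
  have hL := one_le_logb h2
  have hlog := log_le_logb n
  have hsqrt : Real.sqrt n ≤ n.sqrt + 1 := Real.real_sqrt_le_nat_sqrt_succ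
  rw [div_mul_eq_mul_div, div_le_iff₀ hr] at h
  have key : (5 + c) * Real.log n + Real.log (8 * K) ≤ r * n.sqrt := by
    have h1 : (5 + c) * Real.log n ≤ (5 + c) * Real.logb 2 n := by gcongr
    have h3 : Real.log (8 * K) * 1 ≤ Real.log (8 * K) * Real.logb 2 n := by gcongr
    have h4 : r * 1 ≤ r * Real.logb 2 n := by gcongr
    have h5 : Real.sqrt n * r ≤ (n.sqrt + 1) * r := by gcongr
    linarith
  have h6 : (n : ℝ) ^ c * (8 * K * (n : ℝ) ^ 5) ≤ Real.exp (r * n.sqrt) := by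
    refine le_trans (le_of_eq ?_) (Real.exp_le_exp.2 key)
    rw [Real.exp_add, Real.exp_log (by linarith), add_mul, Real.exp_add, mul_comm c,
      ← Real.rpow_def_of_pos hn0]
    have : Real.exp (5 * Real.log n) = (n : ℝ) ^ 5 := by
      rw [← Real.exp_log hn0, ← Real.exp_nat_mul, Real.log_exp]; norm_num
    rw [this]
    ring
  have hc0 : 0 < (n : ℝ) ^ c := Real.rpow_pos_of_pos hn0 c
  rw [Real.exp_neg, ← div_eq_mul_inv, div_le_iff₀ (Real.exp_pos _), mul_one_div, div_mul_eq_mul_div,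
    le_div_iff₀ hc0]
  linarith

/-- The power is at most `n` to the exponent `-(3 / 20) * δ * log* n`, because the floor is at least
`log n / 2`. As `log* n` is unbounded, this exponent drops below `-(c + 3)`: two for the number of
messages, one for the factor `1 / 2`. -/
theorem eventually_sq_mul_pow_le {c δ : ℝ} (hδ : 0 < δ) :
    ∀ᶠ n : ℕ in Filter.atTop,
      (n : ℝ) ^ 2 * Real.exp (-(3 / 10 * δ * ⌊Real.logb 2 n⌋₊)) ^ logStar n ≤
        1 / 2 * (1 / (n : ℝ) ^ c) := by
  obtain ⟨t, ht⟩ := exists_nat_ge ((c + 3) / (3 / 20 * δ))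
  filter_upwards [Filter.eventually_ge_atTop 4, Filter.eventually_gt_atTop (tower t)] with n h4 hn
  have hn0 : (0 : ℝ) < n := by positivity
  have hL : 2 ≤ Real.logb 2 n := by
    rw [Real.le_logb_iff_rpow_le (by norm_num) hn0]
    norm_num
    exact_mod_cast h4
  have hlog := log_le_logb n
  have hlog0 : 0 ≤ Real.log n := Real.log_natCast_nonneg n
  have hk : Real.log n / 2 ≤ ⌊Real.logb 2 n⌋₊ := by
    have := Nat.lt_floor_add_one (Real.logb 2 n)
    linarith
  have hR : c + 3 ≤ 3 / 20 * δ * logStar n := by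
    rw [div_le_iff₀ (by positivity)] at ht
    have h1 : (t : ℝ) ≤ logStar n := by exact_mod_cast (lt_logStar hn).le
    have h2 : (t : ℝ) * (3 / 20 * δ) ≤ logStar n * (3 / 20 * δ) := by gcongr
    linarith
  have h1 : Real.exp (-(3 / 10 * δ * ⌊Real.logb 2 n⌋₊)) ^ logStar n ≤
      (n : ℝ) ^ (-(c + 3)) := by
    rw [← Real.exp_nat_mul, Real.rpow_def_of_pos hn0, Real.exp_le_exp]
    have h2 : logStar n * (3 / 10 * δ * (Real.log n / 2)) ≤
        logStar n * (3 / 10 * δ * ⌊Real.logb 2 n⌋₊) := by gcongr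
    have h3 : (c + 3) * Real.log n ≤ 3 / 20 * δ * logStar n * Real.log n := by gcongr
    linarith
  have h5 : (n : ℝ) ^ 2 * (n : ℝ) ^ (-(c + 3)) = (n : ℝ)⁻¹ * (1 / (n : ℝ) ^ c) := by
    rw [← Real.rpow_natCast, ← Real.rpow_add hn0, one_div, ← Real.rpow_neg hn0.le,
      ← Real.rpow_neg_one, ← Real.rpow_add hn0]
    congr 1
    push_cast
    ring
  have h6 : (n : ℝ)⁻¹ ≤ 1 / 2 := by
    rw [one_div]
    gcongr
    exact_mod_cast (by omega : 2 ≤ n)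
  calc _ ≤ (n : ℝ) ^ 2 * (n : ℝ) ^ (-(c + 3)) := by gcongr
    _ = (n : ℝ)⁻¹ * (1 / (n : ℝ) ^ c) := h5
    _ ≤ _ := by
      have : 0 ≤ 1 / (n : ℝ) ^ c := by positivity
      gcongr

theorem card_eq_sq {n : ℕ} {M : Type*} [Fintype M] {T : Task n M} (hT : T.IsSymmetric) :
    Fintype.card M = n ^ 2 := by
  classical
  rw [← Finset.card_univ, Finset.card_eq_sum_card_fiberwise (f := T.src) (t := Finset.univ)
    (fun _ _ => by simp)]
  simp [fun v => (hT v).1, sq]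

/-- In a good state with nothing held, everything is delivered and at most `4 * r` rounds have
passed. The union bound runs over the `n ^ 2` messages. -/
theorem run_failure_le {n : ℕ} [NeZero n] {M : Type*} [Fintype M] [DecidableEq M] {T : Task n M}
    {tie : TieRule n M} {q : ℕ → Fin 4 → Fin n → Fin n → unitInterval} {p : ℝ} {r C : ℕ}
    {x y B F : ℝ} (hT : T.IsSymmetric) (hC : 4 * r ≤ C) (hB : 0 ≤ B) (hF : 0 ≤ F)
    (hgood : (run p T tie q r).toOuterMeasure {st | Good T x y r st}ᶜ ≤ ENNReal.ofReal B)
    (hheld : ∀ m, (run p T tie q r).toOuterMeasure {st | m ∈ st.held} ≤ ENNReal.ofReal F) :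
    1 - (B + n ^ 2 * F) ≤ ((run p T tie q r).toOuterMeasure
      {st | (∀ m : M, m ∈ st.delivered) ∧ st.rounds ≤ C}).toReal := by
  set E : Set (State n M) := {st | (∀ m : M, m ∈ st.delivered) ∧ st.rounds ≤ C} with hE
  have hbad : (run p T tie q r).toOuterMeasure Eᶜ ≤ ENNReal.ofReal (B + n ^ 2 * F) := by
    have hsub : Eᶜ ⊆ {st | Good T x y r st}ᶜ ∪
        ⋃ m ∈ (Finset.univ : Finset M), {st : State n M | m ∈ st.held} := by
      intro st hst
      by_contra hnot
      simp only [Finset.mem_univ, Set.iUnion_true, Set.mem_union, Set.mem_compl_iff, Set.mem_iUnion,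
        Set.mem_ofPred_eq, not_or, not_not, not_exists] at hnot
      exact hst ⟨fun m => hnot.1.delivered m (hnot.2 m), hnot.1.rounds_le.trans hC⟩
    refine (MeasureTheory.measure_mono hsub).trans ((MeasureTheory.measure_union_le _ _).trans ?_)
    refine (add_le_add hgood (toOuterMeasure_biUnion_le _ _ _ fun m _ => hheld m)).trans_eq ?_
    rw [Finset.card_univ, card_eq_sq hT, ENNReal.ofReal_add hB (by positivity),
      ENNReal.ofReal_mul (by positivity), ENNReal.ofReal_pow (by positivity),
      ENNReal.ofReal_natCast]
    push_cast
    rfl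
  have hne : (run p T tie q r).toOuterMeasure E ≠ ⊤ := by
    refine ne_top_of_le_ne_top ENNReal.one_ne_top ((MeasureTheory.measure_mono
      (Set.subset_univ E)).trans_eq ?_)
    rw [PMF.toOuterMeasure_apply_eq_one_iff]
    exact Set.subset_univ _
  rw [← ENNReal.ofReal_le_iff_le_toReal hne, ENNReal.ofReal_sub _ (by positivity),
    ENNReal.ofReal_one]
  exact (tsub_le_tsub_left hbad 1).trans (one_sub_toOuterMeasure_compl_le _ E)

end LossyDistribution

/-! ### Choice of the constants and conclusion -/

theorem mainTheorem5 (p : ℝ) (hp0 : 0 ≤ p) (hp1 : p < 1) :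
    ∃ (r : ℕ → ℕ) (C : ℕ),
      (∀ n : ℕ, r n ≤ C * LossyDistribution.logStar n) ∧
      ∀ c : ℝ, 0 < c → ∃ N : ℕ, ∀ (n : ℕ) [NeZero n], N ≤ n →
        ∀ (M : Type) [Fintype M] [DecidableEq M] (T : LossyDistribution.Task n M),
          T.IsSymmetric →
          ∀ (tie : LossyDistribution.TieRule n M)
            (q : ℕ → Fin 4 → Fin n → Fin n → unitInterval),
            (∀ i s u w, (q i s u w : ℝ) ≤ p) →
            1 - 1 / (n : ℝ) ^ c ≤
              ((LossyDistribution.run p T tie q (r n)).toOuterMeasure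
                {st | (∀ m : M, m ∈ st.delivered) ∧
                  st.rounds ≤ C * LossyDistribution.logStar n}).toReal := by
  open LossyDistribution in
  obtain ⟨δ, hδ⟩ : ∃ δ, δ = (1 - p) ^ 4 := ⟨_, rfl⟩
  have hδ0 : 0 < δ :=
    hδ ▸ pow_pos (sub_pos.2 hp1) 4
  have hδ1 : δ ≤ 1 := by rw [hδ]; exact pow_le_one₀ (by linarith) (by linarith)
  obtain ⟨ε, hε, hsrc, hdest⟩ := exists_load_lt hδ0 hδ1
  obtain ⟨i₁, hi₁⟩ := exists_copyParam_eq_logb hp1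
  obtain ⟨τ, hτ⟩ : ∃ τ, τ = min δ (ε / 8) := ⟨_, rfl⟩
  have hτ0 : 0 < τ := by rw [hτ]; exact lt_min hδ0 (by linarith)
  -- As `log* n ≥ 1`, after `K * log* n` phases the single-copy stage is over and the number of
  -- copies is maximal, the latter needing `i₁ + 2 * log* n` phases.
  obtain ⟨K, hK⟩ : ∃ K, K = i₁ + ⌈Real.log 2 / (δ / 5)⌉₊ + 2 := ⟨_, rfl⟩
  -- A common exponential rate for the tail bounds of single-copy and low-load phases.
  obtain ⟨κ, hκ⟩ : ∃ κ, κ = min (δ / 20) (-Real.log ((1 + ε / 4) / (1 + ε / 2))) := ⟨_, rfl⟩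
  have hratio0 : 0 < (1 + ε / 4) / (1 + ε / 2) := by positivity
  have hκ0 : 0 < κ := by
    rw [hκ]
    refine lt_min (by linarith) (neg_pos.2 (Real.log_neg hratio0 ?_))
    rw [div_lt_one (by positivity)]
    linarith
  -- The last `log* n` phases run with the maximal number of copies. The factor 4 counts the rounds
  -- of a phase.
  refine ⟨fun n => K * logStar n + logStar n, 4 * (K + 1), fun n => ?_, fun c hc => ?_⟩
  · have : K * logStar n + logStar n = (K + 1) * logStar n := by ring
    simp only [this]
    gcongr
    omega
  obtain ⟨N, hN⟩ := Filter.eventually_atTop.1 ((eventually_large hδ0 hε hτ0).and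
    ((eventually_pow_mul_exp_sqrt_le (K := K + 1) hc hκ0 (by simp)).and
      (eventually_sq_mul_pow_le (c := c) hδ0)))
  refine ⟨N, fun n _ hnN M _ _ T hT tie q hq => ?_⟩
  obtain ⟨hlarge, hfew, hmany⟩ := hN n hnN
  have h2 := hlarge.two_le
  set e := Real.exp (-(κ * n.sqrt)) with he
  have he1 : ((1 + ε / 4) / (1 + ε / 2)) ^ n.sqrt ≤ e := by
    rw [he, ← Real.exp_log hratio0, ← Real.exp_nat_mul, Real.exp_le_exp]
    have h1 : κ * n.sqrt ≤ -Real.log ((1 + ε / 4) / (1 + ε / 2)) * n.sqrt := by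
      gcongr
      rw [hκ]
      exact min_le_right _ _
    linarith
  have he2 : Real.exp (-(δ / 20)) ^ n.sqrt ≤ e := by
    rw [he, ← Real.exp_nat_mul, Real.exp_le_exp]
    have h1 : κ * n.sqrt ≤ δ / 20 * n.sqrt := by
      gcongr
      rw [hκ]
      exact min_le_left _ _
    linarith
  have he0 : 0 < e := Real.exp_pos _
  have hls : 1 ≤ logStar n := lt_logStar (by simp only [tower]; omega)
  have hgood : ∀ i, K * logStar n ≤ i → i ≤ K * logStar n + logStar n →
      (run p T tie q i).toOuterMeasure
        {st | Good T (n / (3 * copyParam p n i)) (n / (4 * copyParam p n i)) i st}ᶜ ≤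
      ENNReal.ofReal (((K * logStar n + logStar n : ℕ) : ℝ) * (2 * n * e)) := by
    intro i hi hi'
    refine (run_not_good_le hp1 hδ hq hT hε hsrc hdest hτ hlarge he1 he2 ?_).trans
      (ENNReal.ofReal_le_ofReal ?_)
    · refine le_trans ?_ ((Nat.le_mul_of_pos_right K hls).trans hi)
      omega
    · gcongr
  have hheld : ∀ m, (run p T tie q (K * logStar n + logStar n)).toOuterMeasure
      {st | m ∈ st.held} ≤ ENNReal.ofReal (Real.exp (-(3 / 10 * δ * ⌊Real.logb 2 n⌋₊)) ^ logStar n +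
        logStar n * (((K * logStar n + logStar n : ℕ) : ℝ) * (2 * n * e))) := by
    intro m
    refine run_mem_held_le (Real.exp_pos _).le (Real.exp_le_one_iff.2 ?_) (by positivity)
      (fun i => {st | Good T (n / (3 * copyParam p n i)) (n / (4 * copyParam p n i)) i st}) m
      (fun i hi hi' => hgood i hi hi'.le) fun i hi _ st hst hm => ?_
    · rw [neg_nonpos]
      positivity
    · have h := phase_mem_held_le (tie := tie) hp1 hδ hq hlarge hst m hm
      have hk : numCopies p n i = ⌊Real.logb 2 n⌋₊ := by
        rw [numCopies, hi₁ n h2 i]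
        refine le_trans ?_ hi
        rw [hK]
        nlinarith
      rwa [hk] at h ⊢
  refine le_trans ?_ (run_failure_le hT ?_ (by positivity) (by positivity)
    (hgood _ (Nat.le_add_right _ _) le_rfl) hheld)
  · have hln : (logStar n : ℝ) ≤ n := by exact_mod_cast logStar_le n
    have hn1 : (1 : ℝ) ≤ n := by exact_mod_cast (by omega : 1 ≤ n)
    set B := ((K * logStar n + logStar n : ℕ) : ℝ) * (2 * n * e) with hBdef
    have hB0 : 0 ≤ B := by positivity
    have hB : B ≤ 2 * ((K : ℝ) + 1) * (n : ℝ) ^ 2 * e := by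
      have h1 : ((K * logStar n + logStar n : ℕ) : ℝ) ≤ (K + 1) * n := by
        push_cast
        nlinarith
      calc B ≤ ((K + 1) * n) * (2 * n * e) := mul_le_mul_of_nonneg_right h1 (by positivity)
        _ = _ := by ring
    -- The failure probability `B` of the invariant is charged once directly and once per message
    -- and final phase. All of this is polynomial in `n`, hence negligible against `e`.
    have h1 : B + n ^ 2 * (logStar n * B) ≤ 4 * ((K : ℝ) + 1) * (n : ℝ) ^ 5 * e := by
      have h3 : 1 ≤ (n : ℝ) ^ 3 := one_le_pow₀ hn1
      have h4 : (n : ℝ) ^ 2 * (logStar n * B) ≤ (n : ℝ) ^ 2 * (n * B) := by gcongr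
      calc B + n ^ 2 * (logStar n * B) ≤ (n : ℝ) ^ 3 * B + (n : ℝ) ^ 3 * B := by
            refine add_le_add (le_mul_of_one_le_left hB0 h3) (h4.trans_eq (by ring))
        _ = 2 * (n : ℝ) ^ 3 * B := by ring
        _ ≤ 2 * (n : ℝ) ^ 3 * (2 * ((K : ℝ) + 1) * (n : ℝ) ^ 2 * e) := by gcongr
        _ = _ := by ring
    linarith
  · have : K * logStar n + logStar n = (K + 1) * logStar n := by ring
    simp only [this, mul_assoc, le_refl]
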